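/- Let $(M_1,Q_1),(M_2,Q_2),\dots$ be independent copies of a random vector $(M,Q)$ in $\mathbb{R}^2$, all defined on one probability space. Put $\Pi_0:=1$, $\Pi_n:=M_1\cdots M_n$ for $n\ge 1$, and $$Z_\infty:=\sum_{k=1}^\infty \Pi_{k-1}Q_k .$$ Assume that $\mathbb{P}\{M=0\}=0$, $\mathbb{P}\{Q=0\}<1$, $$\mathbb{E}\log|M|\in(-\infty,0)\quad\text{and}\quad \mathbb{E}\log^+|Q|<\infty,$$ where $\log^+ x:=\max(0,\log x)$ for $x>0$ and $\log^+0:=0$, and that the distribution of $Z_\infty$ is non-degenerate (not concentrated at one point). Let $b:[0,\infty)\to[0,\infty)$ be a Borel measurable function that is bounded on bounded intervals and regularly varying at $\infty$ with index $\beta>0$, that is, $b$ is positive near $\infty$ and $\lim_{x\to\infty} b(tx)/b(x)=t^\beta$ for every $t>0$; put $c(x):=x\,b(x)$. Then the series defining $Z_\infty$ converges absolutely almost surely, and $$\mathbb{E}\,b(\log^+|Z_\infty|)<\infty\quad\Longleftrightarrow\quad \mathbb{E}\,c(\log^+|M|)<\infty\ \text{ and }\ \mathbb{E}\,c(\log^+|Q|)<\infty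 .$$ -/

import Mathlib

open MeasureTheory ProbabilityTheory Filter Topology
open scoped NNReal ENNReal

namespace Perpetuity

/-- `logPlus x` is `log⁺ |x| = max (0, log |x|)`, as a nonnegative real number. -/
noncomputable def logPlus (x : ℝ) : ℝ≥0 := (Real.posLog |x|).toNNReal

/-- A function `b : [0, ∞) → [0, ∞)` is regularly varying at infinity with index `β`: it is
Borel measurable, positive near infinity, and `b (t x) / b x → t ^ β` as `x → ∞` for every
`t > 0`. -/
structure IsRegularlyVarying (b : ℝ≥0 → ℝ≥0) (β : ℝ) : Prop where
  measurable : Measurable b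
  eventually_pos : ∀ᶠ x in atTop, 0 < b x
  tendsto : ∀ t : ℝ≥0, 0 < t → Tendsto (fun x => b (t * x) / b x) atTop (𝓝 (t ^ β))

/-- The products `Π₀ = 1` and `Πₙ = M₁ ⋯ Mₙ`. The sequence is indexed from zero, so that `M i` is
the variable written `M_{i+1}` in the usual numbering. -/
def prodPi {Ω : Type*} (M : ℕ → Ω → ℝ) (n : ℕ) (ω : Ω) : ℝ := ∏ i ∈ Finset.range n, M i ω

/-- The random series `∑_{k ≥ 1} Π_{k-1} Q_k`; with indices from zero, `∑_{k ≥ 0} Π_k (Q k)`. -/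
noncomputable def zInf {Ω : Type*} (M Q : ℕ → Ω → ℝ) (ω : Ω) : ℝ :=
  ∑' k : ℕ, prodPi M k ω * Q k ω

end Perpetuity

/-!
The moment function `b` is first replaced by a gauge `B` (`IsGauge`): a monotone function bounded
below by `1` with `B (2 x) ≤ D B x` and `B (x + K) / B x → 1`. The monotone majorant of `b` is one
(`isGauge_majorant`), and it is comparable to `1 + b` because a regularly varying function of
positive index is almost increasing (`almost_increasing`); both facts rest on a local form of the
uniform convergence theorem (`eventually_abs_sub_le`). So finiteness of `E b` and `E c` at `log⁺`
of a variable may be read with `B y` and `y B y` in place of `b y` and `c y`. Convergence of the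
series is the strong law of large numbers for `log |M|`, together with `log⁺ |Qₙ| = o(n)`.

Write `Aₙ` for the partial sums, `Πₙ` for the products.

*Sufficiency.* For small `ε > 0`, `|Aₙ| ≤ C exp Rₙ`, where `Rₙ` is the maximum of `0` and of the
exponents `ε k + log |Πₖ| + log⁺ |Qₖ|`, `k < n`. In law, `Rₙ₊₁ = max (log⁺ |Q|) (Rₙ + ε + log |M|)`,
a random walk with negative drift, reflected by an immigration term. The convex function
`V x = ∫₀ˣ B` is a Lyapunov function: `E V(Rₙ₊₁) - E V(Rₙ) ≤ -γ E B(Rₙ) + const` with `γ > 0`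
(`IsGauge.exists_drift`), where the constant is finite thanks to the moments of order `y B y`.
Summing over `n`, and since `Rₙ` increases with `n`, the expectations `E B(Rₙ)` are bounded
(`exists_integral_envelope_le`). Fatou's lemma concludes (`lintegral_perpetuity_lt_top`).

*Necessity.* Let `Y` be `M` or `Q`. Write `Z = Aₙ₊₁ + Πₙ₊₁ Z'`, with `Z'` a copy of `Z` independent
of the past. Since `Z` is nondegenerate, `|Z|` is with probability at least `p > 0` of the order of
`max |Aₙ₊₁| |Πₙ₊₁|` (`exists_affine_lower_bound`). With probability at least `3/4` the path is tame:
`|Πₙ| ≥ exp (-a n - L)` and `|Aₙ| ≤ L` for all `n` (`exists_tame`). When `n` is the first time that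
`log⁺ |Yₙ| > x₀ + a n`, a tame path has `max |Aₙ₊₁| |Πₙ₊₁|` at least of the order of
`exp (log⁺ |Yₙ| - a n - L)`. These events are disjoint for different `n`, and their
contributions to `E B(log⁺ |Z|)` sum to at least a constant times
`∑ₙ E[B(log⁺ |Y| - a n - L'); log⁺ |Y| > x₀ + a n]`, which is of the order of
`E[log⁺ |Y| B(log⁺ |Y|)]` (`lintegral_mul_lt_top_of_lintegral_perpetuity`).
-/

namespace Perpetuity

/-! ### Regular variation and gauges -/

/-- Pointwise convergence of the increments implies convergence in measure on bounded intervals.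
This is where measurability of a regularly varying function is used. -/
theorem tendsto_volume_badSet {f : ℝ → ℝ} (hf : Measurable f) {β : ℝ}
    (h : ∀ s, Tendsto (fun x => f (x + s) - f x) atTop (𝓝 (β * s))) {ε : ℝ} (hε : 0 < ε) (a : ℝ) :
    Tendsto (fun x => volume ({s | ε < |f (x + s) - f x - β * s|} ∩ Set.Icc 0 a)) atTop (𝓝 0) := by
  have hm : ∀ x, MeasurableSet {s | ε < |f (x + s) - f x - β * s|} := fun x =>
    measurableSet_lt measurable_const (by fun_prop)
  have key := tendsto_lintegral_filter_of_dominated_convergence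
    (μ := volume.restrict (Set.Icc 0 a)) (l := (atTop : Filter ℝ))
    (F := fun x s => Set.indicator {s | ε < |f (x + s) - f x - β * s|} (fun _ => (1 : ℝ≥0∞)) s)
    (f := fun _ => 0) (fun _ => 1)
    (Eventually.of_forall fun x => measurable_const.indicator (hm x))
    (Eventually.of_forall fun x => ae_of_all _ fun s => Set.indicator_le_self' (by simp) s)
    (by simp)
    (ae_of_all _ fun s => by
      refine tendsto_const_nhds.congr' ?_
      have h1 := (h s).sub_const (β * s)
      rw [sub_self] at h1
      have h2 := h1.abs
      rw [abs_zero] at h2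
      filter_upwards [h2.eventually_lt_const hε] with x hx
      rw [Set.indicator_of_notMem]
      simpa using hx.le)
  simp only [lintegral_zero] at key
  refine key.congr fun x => ?_
  rw [lintegral_indicator_const (hm x), one_mul, Measure.restrict_apply (hm x)]

/-- Local uniformity in the additive form of the uniform convergence theorem for regularly varying
functions. For `u ∈ [0, τ]` the increments from `x` and from `x + u` are both close to their limits
off small sets of shifts, and some shift leading to a common point is good for both. -/
theorem eventually_abs_sub_le {f : ℝ → ℝ} (hf : Measurable f) {β : ℝ}
    (h : ∀ s, Tendsto (fun x => f (x + s) - f x) atTop (𝓝 (β * s))) {ε : ℝ} (hε : 0 < ε) :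
    ∃ τ > 0, ∀ᶠ x in atTop, ∀ u ∈ Set.Icc 0 τ, |f (x + u) - f x| ≤ ε := by
  set τ : ℝ := ε / (2 * (|β| + 1)) with hτ
  have hβ : 0 ≤ |β| := abs_nonneg β
  have hτ0 : 0 < τ := by positivity
  have hβτ : |β| * τ ≤ ε / 2 := by
    rw [hτ, ← mul_div_assoc, div_le_div_iff₀ (by positivity) (by positivity)]
    nlinarith
  refine ⟨τ, hτ0, ?_⟩
  have hev := (tendsto_volume_badSet hf h (ε := ε / 4) (by positivity) (2 * τ)).eventually_lt_const
    (u := ENNReal.ofReal (τ / 2)) (by simpa using hτ0)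
  obtain ⟨X, hX⟩ := eventually_atTop.1 hev
  refine eventually_atTop.2 ⟨X, fun x hx u hu => ?_⟩
  have h1 := hX x hx
  have h2 := hX (x + u) (by linarith [hu.1])
  set A := {s | ε / 4 < |f (x + s) - f x - β * s|} ∩ Set.Icc 0 (2 * τ)
  set A' := {s | ε / 4 < |f (x + u + s) - f (x + u) - β * s|} ∩ Set.Icc 0 (2 * τ)
  have h3 : volume ((fun s => s + -u) ⁻¹' A') < ENNReal.ofReal (τ / 2) := by
    rwa [measure_preimage_add_right]
  have hne : ¬ Set.Icc τ (2 * τ) ⊆ A ∪ (fun s => s + -u) ⁻¹' A' := by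
    intro hsub
    have h4 := (measure_mono hsub).trans (measure_union_le (μ := volume) _ _)
    have h5 := h4.trans_lt (ENNReal.add_lt_add h1 h3)
    rw [Real.volume_Icc, ← ENNReal.ofReal_add (by positivity) (by positivity)] at h5
    ring_nf at h5
    exact lt_irrefl _ h5
  obtain ⟨s, hs, hns⟩ := Set.not_subset.1 hne
  simp only [Set.mem_union, not_or] at hns
  have hu1 := hu.1
  have hu2 := hu.2
  have h6 : |f (x + s) - f x - β * s| ≤ ε / 4 := by
    by_contra hc
    exact hns.1 ⟨not_le.1 hc, by linarith [hs.1], hs.2⟩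
  have h7 : |f (x + u + (s + -u)) - f (x + u) - β * (s + -u)| ≤ ε / 4 := by
    by_contra hc
    exact hns.2 ⟨not_le.1 hc, by linarith [hs.1], by linarith [hs.2]⟩
  rw [show x + u + (s + -u) = x + s by ring] at h7
  have h8 : |β * u| ≤ ε / 2 := by
    rw [abs_mul, abs_of_nonneg hu1]
    exact (mul_le_mul_of_nonneg_left hu2 hβ).trans hβτ
  rw [abs_le] at *
  constructor <;> linarith [h6.1, h6.2, h7.1, h7.2, h8.1, h8.2]

/-- A function playing the part of a regularly varying moment function, with the regularity that
moment estimates use: it is monotone, bounded below by `1`, of moderate growth, and asymptotically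
insensitive to translations. -/
structure IsGauge (B : ℝ → ℝ) : Prop where
  mono : Monotone B
  one_le : ∀ x, 1 ≤ B x
  doubling : ∃ D, ∀ x, 0 ≤ x → B (2 * x) ≤ D * B x
  translate : ∀ K ε, 0 < ε → ∀ᶠ x in atTop, B (x + K) ≤ (1 + ε) * B x

namespace IsRegularlyVarying

variable {b : ℝ≥0 → ℝ≥0} {β : ℝ}

theorem tendsto_real (hb : IsRegularlyVarying b β) {t : ℝ} (ht : 0 < t) :
    Tendsto (fun x : ℝ => (b (t * x).toNNReal : ℝ) / b x.toNNReal) atTop (𝓝 (t ^ β)) := by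
  have h1 := ((NNReal.continuous_coe.tendsto _).comp (hb.tendsto t.toNNReal (by simpa))).comp
    tendsto_real_toNNReal_atTop
  have h2 : ((t.toNNReal ^ β : ℝ≥0) : ℝ) = t ^ β := by
    rw [NNReal.coe_rpow, Real.coe_toNNReal _ ht.le]
  rw [h2] at h1
  refine h1.congr fun x => ?_
  simp [Function.comp, Real.toNNReal_mul ht.le]

theorem eventually_pos_real (hb : IsRegularlyVarying b β) :
    ∀ᶠ x : ℝ in atTop, 0 < (b x.toNNReal : ℝ) := by
  filter_upwards [tendsto_real_toNNReal_atTop.eventually hb.eventually_pos] with x hx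
  exact_mod_cast hx

/-- The ratios `b (t x) / b x` are uniformly close to `1` for `t` in a right neighbourhood of `1`.
-/
theorem eventually_local (hb : IsRegularlyVarying b β) {ε : ℝ} (hε : 0 < ε) :
    ∃ τ > 1, ∀ᶠ x : ℝ in atTop, ∀ t ∈ Set.Icc 1 τ,
      (b (t * x).toNNReal : ℝ) ≤ (1 + ε) * b x.toNNReal ∧
      (b x.toNNReal : ℝ) ≤ (1 + ε) * b (t * x).toNNReal := by
  have hpos := Real.tendsto_exp_atTop.eventually hb.eventually_pos_real
  obtain ⟨τ, hτ, h⟩ := eventually_abs_sub_le (f := fun u => Real.log (b (Real.exp u).toNNReal))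
    (β := β) (ε := Real.log (1 + ε))
    (by
      have := hb.measurable
      fun_prop)
    (fun s => by
      have h1 := (hb.tendsto_real (Real.exp_pos s)).comp Real.tendsto_exp_atTop
      have h2 := h1.log (by positivity)
      rw [← Real.exp_mul, Real.log_exp, mul_comm] at h2
      refine h2.congr' ?_
      have h3 := (tendsto_atTop_add_const_right atTop s tendsto_id).eventually hpos
      filter_upwards [hpos, h3] with x hx hx'
      simp only [id] at hx'
      rw [Function.comp_apply, ← Real.exp_add, add_comm s, Real.log_div hx'.ne' hx.ne'])
    (Real.log_pos (by linarith))
  refine ⟨Real.exp τ, by simpa using hτ, ?_⟩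
  have h4 := eventually_forall_ge_atTop.2 hpos
  have h5 := Real.tendsto_log_atTop.eventually (h.and h4)
  filter_upwards [h5, eventually_gt_atTop 0] with x hx hx0 t ht
  have ht0 : 0 < t := by linarith [ht.1]
  have hlt : Real.log t ∈ Set.Icc 0 τ :=
    ⟨Real.log_nonneg ht.1, (Real.log_le_iff_le_exp ht0).2 ht.2⟩
  have h6 := hx.1 _ hlt
  have h7 := hx.2 _ le_rfl
  have h8 := hx.2 (Real.log x + Real.log t) (by linarith [hlt.1])
  rw [Real.exp_add, Real.exp_log hx0, Real.exp_log ht0, mul_comm x] at h6 h8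
  rw [Real.exp_log hx0] at h7
  rw [abs_le] at h6
  constructor
  · rw [← Real.log_le_log_iff h8 (by positivity), Real.log_mul (by positivity) h7.ne']
    linarith [h6.2]
  · rw [← Real.log_le_log_iff h7 (by positivity), Real.log_mul (by positivity) h8.ne']
    linarith [h6.1]

/-- A regularly varying function of positive index is almost increasing: along geometric
progressions it increases eventually, and on bounded ratios it is locally comparable. -/
theorem almost_increasing (hb : IsRegularlyVarying b β) (hβ : 0 < β) :
    ∃ X : ℝ, 0 < X ∧ ∀ y : ℝ, X ≤ y → ∀ x : ℝ, y ≤ x → (b y.toNNReal : ℝ) ≤ 2 * b x.toNNReal := by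
  obtain ⟨τ, hτ, h⟩ := hb.eventually_local one_pos
  have hτ0 : 0 < τ := by linarith
  have h1 := (hb.tendsto_real hτ0).eventually_const_lt (Real.one_lt_rpow hτ hβ)
  obtain ⟨X, hX⟩ := eventually_atTop.1 (h.and (h1.and hb.eventually_pos_real))
  refine ⟨max X 1, by positivity, fun y hy x hxy => ?_⟩
  have hy1 : 1 ≤ y := (le_max_right _ _).trans hy
  have hyX : X ≤ y := (le_max_left _ _).trans hy
  have hpow : ∀ (n : ℕ) (z : ℝ), X ≤ z → 0 ≤ z →
      (b z.toNNReal : ℝ) ≤ b (τ ^ n * z).toNNReal := by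
    intro n
    induction n with
    | zero => intro z _ _; simp
    | succ n ih =>
      intro z hz hz0
      have hzz : z ≤ τ * z := by nlinarith
      have h2 := ih (τ * z) (hz.trans hzz) (hz0.trans hzz)
      have h3 := (hX z hz).2
      rw [one_lt_div h3.2] at h3
      rw [pow_succ, mul_assoc]
      exact h3.1.le.trans h2
  obtain ⟨n, hn1, hn2⟩ := exists_nat_pow_near (x := x / y) (by rwa [one_le_div (by linarith)]) hτ
  have hp : 0 < τ ^ n := by positivity
  set t := x / y / τ ^ n with ht
  have ht1 : 1 ≤ t := by rwa [ht, one_le_div hp]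
  have ht2 : t ≤ τ := by
    rw [ht, div_le_iff₀ hp, ← pow_succ']; exact hn2.le
  have hx : x = τ ^ n * (t * y) := by
    rw [ht]; field_simp
  have hty : y ≤ t * y := by nlinarith
  have h4 := ((hX y hyX).1 t ⟨ht1, ht2⟩).2
  have h5 := hpow n (t * y) (hyX.trans hty) (by linarith)
  rw [hx]
  linarith

/-- The smallest monotone majorant of `b`, increased by `1`. -/
noncomputable def majorant (b : ℝ≥0 → ℝ≥0) (x : ℝ) : ℝ :=
  1 + (sSup (b '' Set.Iic x.toNNReal) : ℝ≥0)

theorem le_majorant (hbdd : ∀ r : ℝ≥0, BddAbove (b '' Set.Iic r)) {y : ℝ≥0} {x : ℝ}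
    (h : y ≤ x.toNNReal) : 1 + (b y : ℝ) ≤ majorant b x := by
  unfold majorant
  gcongr
  exact le_csSup (hbdd _) ⟨y, h, rfl⟩

theorem majorant_le {x C : ℝ} (hC : ∀ y : ℝ≥0, y ≤ x.toNNReal → 1 + (b y : ℝ) ≤ C) :
    majorant b x ≤ C := by
  have h0 : 0 ≤ C - 1 := by
    have := hC 0 (by simp)
    have h0 : (0 : ℝ) ≤ b 0 := NNReal.coe_nonneg _
    linarith
  have : sSup (b '' Set.Iic x.toNNReal) ≤ (C - 1).toNNReal := by
    refine csSup_le ⟨_, ⟨0, by simp, rfl⟩⟩ ?_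
    rintro _ ⟨y, hy, rfl⟩
    rw [Real.le_toNNReal_iff_coe_le h0]
    linarith [hC y hy]
  have h2 : ((sSup (b '' Set.Iic x.toNNReal) : ℝ≥0) : ℝ) ≤ C - 1 := by
    rwa [Real.le_toNNReal_iff_coe_le h0] at this
  unfold majorant
  linarith

theorem one_le_majorant (x : ℝ) : 1 ≤ majorant b x := by
  unfold majorant
  linarith [NNReal.coe_nonneg (sSup (b '' Set.Iic x.toNNReal))]

theorem majorant_mono (hbdd : ∀ r : ℝ≥0, BddAbove (b '' Set.Iic r)) : Monotone (majorant b) :=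
  fun _ _ hxy => majorant_le fun _ hz => le_majorant hbdd (hz.trans (Real.toNNReal_le_toNNReal hxy))

/-- The majorant inherits its growth properties from uniform local control of `b`: on `[0, x]` it is
bounded by its value at `x`, and beyond `x` the function `b` is compared with its values below. -/
theorem isGauge_majorant (hb : IsRegularlyVarying b β)
    (hbdd : ∀ r : ℝ≥0, BddAbove (b '' Set.Iic r)) : IsGauge (majorant b) where
  mono := majorant_mono hbdd
  one_le := one_le_majorant
  doubling := by
    have h1 := (hb.tendsto_real (t := 2) two_pos).eventually_lt_const (lt_add_one _)
    obtain ⟨X, hX⟩ := eventually_atTop.1 (h1.and hb.eventually_pos_real)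
    set D := (2 : ℝ) ^ β + 1
    have hD : 0 < D := by positivity
    refine ⟨1 + D + majorant b (2 * X), fun x hx => majorant_le fun y hy => ?_⟩
    have hm := one_le_majorant (b := b) (2 * X)
    have hmx := one_le_majorant (b := b) x
    rcases le_total (y : ℝ) (2 * X) with hyX | hyX
    · have h2 := le_majorant hbdd (NNReal.le_toNNReal_of_coe_le hyX)
      nlinarith
    · have h3 := hX ((y : ℝ) / 2) (by linarith)
      rw [div_lt_iff₀ h3.2, show 2 * ((y : ℝ) / 2) = y by ring, Real.toNNReal_coe] at h3
      have h4 := le_majorant (x := x) (y := ((y : ℝ) / 2).toNNReal) hbdd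
        (Real.toNNReal_le_toNNReal (by
          have := (Real.le_toNNReal_iff_coe_le (by linarith)).1 hy
          linarith))
      nlinarith [h3.1, h3.2]
  translate := by
    intro K ε hε
    obtain ⟨τ, hτ, h⟩ := hb.eventually_local hε
    filter_upwards [h, eventually_ge_atTop 1, eventually_ge_atTop (-K),
      eventually_ge_atTop (K / (τ - 1))] with x hx hx1 hxK hxτ
    refine majorant_le fun y hy => ?_
    have hmx := one_le_majorant (b := b) x
    rcases le_total (y : ℝ) x with hyx | hyx
    · have h2 := le_majorant hbdd (NNReal.le_toNNReal_of_coe_le hyx)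
      nlinarith
    · have hy' := (Real.le_toNNReal_iff_coe_le (by linarith)).1 hy
      rw [div_le_iff₀ (by linarith)] at hxτ
      have h3 := (hx (y / x) ⟨by rwa [one_le_div (by linarith)], by
        rw [div_le_iff₀ (by linarith)]; linarith⟩).1
      rw [div_mul_cancel₀ _ (by linarith), Real.toNNReal_coe] at h3
      have h4 := le_majorant (x := x) (y := x.toNNReal) hbdd le_rfl
      nlinarith

/-- Almost monotonicity makes the majorant comparable to `1 + b`. -/
theorem majorant_le_mul (hb : IsRegularlyVarying b β) (hβ : 0 < β)
    (hbdd : ∀ r : ℝ≥0, BddAbove (b '' Set.Iic r)) :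
    ∃ C : ℝ, 0 ≤ C ∧ ∀ x : ℝ≥0, majorant b x ≤ C * (1 + b x) := by
  obtain ⟨X, hX0, hX⟩ := hb.almost_increasing hβ
  have hm := one_le_majorant (b := b) X
  refine ⟨majorant b X + 2, by linarith, fun x => majorant_le fun y hy => ?_⟩
  rw [Real.toNNReal_coe] at hy
  have hbx : (0 : ℝ) ≤ b x := NNReal.coe_nonneg _
  rcases le_total (y : ℝ) X with hyX | hyX
  · have h2 := le_majorant hbdd (NNReal.le_toNNReal_of_coe_le hyX)
    nlinarith
  · have h3 := hX y hyX x (by exact_mod_cast hy)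
    simp only [Real.toNNReal_coe] at h3
    nlinarith

end IsRegularlyVarying

/-! ### The drift condition -/

namespace IsGauge

variable {B : ℝ → ℝ}

theorem nonneg (hB : IsGauge B) (x : ℝ) : 0 ≤ B x := zero_le_one.trans (hB.one_le x)

theorem exists_doubling (hB : IsGauge B) :
    ∃ D, 1 ≤ D ∧ ∀ x, 0 ≤ x → B (2 * x) ≤ D * B x := by
  obtain ⟨D, hD⟩ := hB.doubling
  refine ⟨max D 1, le_max_right _ _, fun x hx => (hD x hx).trans ?_⟩
  exact mul_le_mul_of_nonneg_right (le_max_left _ _) (hB.nonneg x)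

theorem exists_add_le (hB : IsGauge B) :
    ∃ D, 1 ≤ D ∧ ∀ x y, 0 ≤ x → 0 ≤ y → B (x + y) ≤ D * (B x + B y) := by
  obtain ⟨D, hD1, hD⟩ := hB.exists_doubling
  refine ⟨D, hD1, fun x y hx hy => ?_⟩
  have hx0 := hB.nonneg x
  have hy0 := hB.nonneg y
  rcases le_total x y with h | h
  · have h1 := (hB.mono (by linarith : x + y ≤ 2 * y)).trans (hD y hy)
    nlinarith
  · have h1 := (hB.mono (by linarith : x + y ≤ 2 * x)).trans (hD x hx)
    nlinarith

variable {α : Type*} [MeasurableSpace α] {μ : Measure α} [IsProbabilityMeasure μ] {φ : α → ℝ}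

theorem integrable_add (hB : IsGauge B) (hφ : Measurable φ) (h0 : ∀ a, 0 ≤ φ a)
    (h : Integrable (fun a => φ a * B (φ a)) μ) {c : ℝ} (hc : 0 ≤ c) :
    Integrable (fun a => (φ a + c) * B (φ a + c)) μ := by
  obtain ⟨D, hD1, hD⟩ := hB.exists_doubling
  have hBm := hB.mono.measurable
  refine Integrable.mono' ((h.const_mul (2 * D)).add (integrable_const (2 * c * B (2 * c))))
    (by fun_prop : Measurable _).aestronglyMeasurable (ae_of_all _ fun a => ?_)
  have h1 := hB.nonneg (φ a)
  have h2 := hB.nonneg (2 * c)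
  have h3 := h0 a
  rw [Real.norm_of_nonneg (mul_nonneg (by linarith) (hB.nonneg _)), Pi.add_apply]
  rcases le_total (φ a) c with h4 | h4
  · have h5 : (φ a + c) * B (φ a + c) ≤ 2 * c * B (2 * c) :=
      mul_le_mul (by linarith) (hB.mono (by linarith)) (hB.nonneg _) (by linarith)
    have : 0 ≤ 2 * D * (φ a * B (φ a)) := by positivity
    linarith
  · have h5 : (φ a + c) * B (φ a + c) ≤ 2 * φ a * (D * B (φ a)) :=
      mul_le_mul (by linarith) ((hB.mono (by linarith)).trans (hD _ h3)) (hB.nonneg _)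
        (by linarith)
    have : 0 ≤ 2 * c * B (2 * c) := by positivity
    linarith

end IsGauge

/-- The primitive of a gauge, which serves as Lyapunov function for random walks with negative
drift reflected at the origin. -/
noncomputable def primitive (B : ℝ → ℝ) (x : ℝ) : ℝ := ∫ t in (0 : ℝ)..x, B t

namespace IsGauge

variable {B : ℝ → ℝ}

/-- The tangent inequality for the convex function `primitive B`, valid on both sides of `x`. -/
theorem primitive_sub_le (hB : IsGauge B) (x y : ℝ) :
    primitive B y - primitive B x ≤ (y - x) * B y := by
  have hi : ∀ a b, IntervalIntegrable B volume a b := fun a b => hB.mono.intervalIntegrable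
  unfold primitive
  rw [intervalIntegral.integral_interval_sub_left (hi _ _) (hi _ _)]
  have hc : ∀ a b : ℝ, ∫ _ in a..b, B y = (b - a) * B y := fun a b => by simp
  rcases le_total x y with h | h
  · rw [← hc]
    exact intervalIntegral.integral_mono_on h (hi _ _) (by simp) fun t ht => hB.mono ht.2
  · have h1 := intervalIntegral.integral_mono_on h (f := fun _ => B y) (by simp) (hi y x)
      fun t ht => hB.mono ht.1
    rw [hc] at h1
    rw [intervalIntegral.integral_symm]
    linarith

theorem primitive_mono (hB : IsGauge B) : Monotone (primitive B) := fun x y h => by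
  have h1 := hB.primitive_sub_le y x
  have h2 := hB.nonneg x
  nlinarith

theorem primitive_zero : primitive B 0 = 0 := by simp [primitive]

theorem primitive_nonneg (hB : IsGauge B) {x : ℝ} (hx : 0 ≤ x) : 0 ≤ primitive B x :=
  primitive_zero (B := B) ▸ hB.primitive_mono hx

theorem primitive_le (hB : IsGauge B) (x : ℝ) : primitive B x ≤ x * B x := by
  simpa [primitive_zero] using hB.primitive_sub_le 0 x

theorem exists_le_primitive (hB : IsGauge B) :
    ∃ C, 0 ≤ C ∧ ∀ x, 0 ≤ x → B x ≤ C * (1 + primitive B x) := by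
  obtain ⟨D, hD1, hD⟩ := hB.exists_doubling
  have h2 := hB.one_le 2
  refine ⟨D + B 2, by linarith, fun x hx => ?_⟩
  have hp := hB.primitive_nonneg hx
  rcases le_total x 2 with h | h
  · have := hB.mono h
    nlinarith
  · have h3 := hD (x / 2) (by linarith)
    rw [mul_div_cancel₀ x two_ne_zero] at h3
    -- on `[x / 2, x]` the integrand is at least `B (x / 2)`
    have h4 := hB.primitive_sub_le x (x / 2)
    have h5 := hB.primitive_nonneg (by linarith : 0 ≤ x / 2)
    have h6 := hB.nonneg (x / 2)
    have h7 : B (x / 2) ≤ primitive B x := by nlinarith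
    nlinarith

end IsGauge

/-- The coefficient of `B x` in the drift estimate for an increment `y`: positive increments are
slightly enlarged, negative ones slightly reduced and truncated at level `n`, and increments above
`n` are charged an extra factor. It tends to `y` as `n → ∞`. -/
noncomputable def driftCoeff (D : ℝ) (n : ℕ) (y : ℝ) : ℝ :=
  (1 + 1 / ((n : ℝ) + 1)) * max y 0 - (1 + 1 / ((n : ℝ) + 1))⁻¹ * min (max (-y) 0) n +
    D * (if (n : ℝ) < y then y else 0)

theorem measurable_driftCoeff (D : ℝ) (n : ℕ) : Measurable (driftCoeff D n) := by
  have : Measurable fun y : ℝ => if (n : ℝ) < y then y else 0 :=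
    Measurable.ite measurableSet_Ioi measurable_id measurable_const
  unfold driftCoeff
  fun_prop

theorem abs_driftCoeff_le {D : ℝ} (hD : 0 ≤ D) (n : ℕ) (y : ℝ) :
    |driftCoeff D n y| ≤ (3 + D) * |y| := by
  have hn : (0 : ℝ) ≤ n := n.cast_nonneg
  set θ := 1 / ((n : ℝ) + 1)
  have hθ0 : 0 ≤ θ := by positivity
  have hθ1 : θ ≤ 1 := by
    rw [div_le_one (by positivity)]; linarith
  have hinv0 : 0 ≤ (1 + θ)⁻¹ := by positivity
  have hinv1 : (1 + θ)⁻¹ ≤ 1 := inv_le_one_of_one_le₀ (by linarith)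
  have hy := abs_nonneg y
  have h1 : 0 ≤ max y 0 ∧ max y 0 ≤ |y| := ⟨le_max_right _ _, max_le (le_abs_self y) hy⟩
  have h2 : 0 ≤ min (max (-y) 0) n ∧ min (max (-y) 0) n ≤ |y| :=
    ⟨le_min (le_max_right _ _) hn, (min_le_left _ _).trans (max_le (neg_le_abs y) hy)⟩
  have h3 : 0 ≤ (if (n : ℝ) < y then y else 0) ∧ (if (n : ℝ) < y then y else 0) ≤ |y| := by
    split_ifs with h
    · exact ⟨by linarith, le_abs_self y⟩
    · exact ⟨le_rfl, hy⟩
  unfold driftCoeff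
  rw [abs_le]
  constructor <;> nlinarith [mul_nonneg hθ0 h1.1, mul_nonneg hinv0 h2.1, mul_nonneg hD h3.1,
    mul_le_mul_of_nonneg_left h3.2 hD, mul_le_mul hinv1 h2.2 h2.1 zero_le_one,
    mul_le_mul hθ1 h1.2 h1.1 zero_le_one, mul_nonneg hD hy]

theorem tendsto_driftCoeff (D y : ℝ) :
    Tendsto (fun n => driftCoeff D n y) atTop (𝓝 y) := by
  have h1 : Tendsto (fun n : ℕ => 1 + 1 / ((n : ℝ) + 1)) atTop (𝓝 1) := by
    simpa using tendsto_one_div_add_atTop_nhds_zero_nat.const_add (1 : ℝ)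
  have h2 : Tendsto (fun n : ℕ => (1 + 1 / ((n : ℝ) + 1)) * max y 0 -
      (1 + 1 / ((n : ℝ) + 1))⁻¹ * max (-y) 0) atTop (𝓝 y) := by
    have := (h1.mul_const (max y 0)).sub ((h1.inv₀ one_ne_zero).mul_const (max (-y) 0))
    convert this using 2
    rcases le_total y 0 with h | h <;> simp [h]
  refine h2.congr' ?_
  filter_upwards [eventually_ge_atTop ⌈|y|⌉₊] with n hn
  have hy : |y| ≤ n := Nat.ceil_le.1 hn
  have h3 : ¬ (n : ℝ) < y := not_lt.2 ((le_abs_self y).trans hy)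
  unfold driftCoeff
  rw [if_neg h3, min_eq_left (max_le ((neg_le_abs y).trans hy) n.cast_nonneg)]
  ring

/-- The drift estimate away from the origin. -/
theorem IsGauge.primitive_sub_le_of_large {B : ℝ → ℝ} (hB : IsGauge B) {D : ℝ} (hD1 : 1 ≤ D)
    (hD : ∀ x y, 0 ≤ x → 0 ≤ y → B (x + y) ≤ D * (B x + B y)) (n : ℕ) {x : ℝ} (hx : (n : ℝ) ≤ x)
    (h1 : B (x + n) ≤ (1 + 1 / ((n : ℝ) + 1)) * B x)
    (h2 : B x ≤ (1 + 1 / ((n : ℝ) + 1)) * B (x - n)) (y : ℝ) :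
    primitive B (max 0 (x + y)) - primitive B x ≤
      B x * driftCoeff D n y + D * (max y 0 * B (max y 0)) := by
  have hn : (0 : ℝ) ≤ n := n.cast_nonneg
  unfold driftCoeff
  set θ := 1 / ((n : ℝ) + 1)
  have hθ0 : 0 ≤ θ := by positivity
  have hx0 : 0 ≤ B x := hB.nonneg x
  rcases lt_or_ge y 0 with hy | hy
  · rw [max_eq_right hy.le, if_neg (by linarith), max_eq_left (by linarith : 0 ≤ -y)]
    set z := min (-y) (n : ℝ)
    have hz0 : 0 ≤ z := le_min (by linarith) hn
    have hz1 : z ≤ -y := min_le_left _ _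
    have hz2 : z ≤ n := min_le_right _ _
    have h3 : primitive B (max 0 (x + y)) ≤ primitive B (x - z) :=
      hB.primitive_mono (max_le (by linarith) (by linarith))
    have h4 := hB.primitive_sub_le x (x - z)
    have h5 : B (x - n) ≤ B (x - z) := hB.mono (by linarith)
    have h6 : (1 + θ)⁻¹ * B x ≤ B (x - z) := by
      rw [inv_mul_le_iff₀ (by linarith)]
      exact h2.trans (mul_le_mul_of_nonneg_left h5 (by linarith))
    have h7 := mul_le_mul_of_nonneg_left h6 hz0
    linarith
  · rw [max_eq_left hy, max_eq_right (by linarith : -y ≤ 0), max_eq_right (by linarith : 0 ≤ x + y),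
      min_eq_left hn]
    have h4 := hB.primitive_sub_le x (x + y)
    rw [add_sub_cancel_left] at h4
    have hy0 := mul_nonneg hy (hB.nonneg y)
    split_ifs with hny
    · have h5 := mul_le_mul_of_nonneg_left (hD x y (by linarith) hy) hy
      have h6 : 0 ≤ (1 + θ) * (y * B x) := by positivity
      linarith
    · have h5 := mul_le_mul_of_nonneg_left
        ((hB.mono (by linarith : x + y ≤ x + n)).trans h1) hy
      have h6 : 0 ≤ D * (y * B y) := by positivity
      linarith

/-- Foster's drift condition for a reflected random walk whose increments have negative mean and
a finite moment of order `y ↦ y B y`. -/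
theorem IsGauge.exists_drift {B : ℝ → ℝ} (hB : IsGauge B) {α : Type*} [MeasurableSpace α]
    {μ : Measure α} [IsProbabilityMeasure μ] {h : α → ℝ} (hm : Measurable h)
    (hi : Integrable h μ) (hneg : ∫ a, h a ∂μ < 0)
    (hmom : Integrable (fun a => max (h a) 0 * B (max (h a) 0)) μ) :
    ∃ g G : α → ℝ, Integrable g μ ∧ ∫ a, g a ∂μ < 0 ∧ Integrable G μ ∧ ∀ x a, 0 ≤ x →
        primitive B (max 0 (x + h a)) - primitive B x ≤ B x * g a + G a := by
  obtain ⟨D, hD1, hD⟩ := hB.exists_add_le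
  have hD0 : 0 ≤ D := by linarith
  have hlim : Tendsto (fun n => ∫ a, driftCoeff D n (h a) ∂μ) atTop (𝓝 (∫ a, h a ∂μ)) :=
    tendsto_integral_of_dominated_convergence (fun a => (3 + D) * |h a|)
      (fun n => ((measurable_driftCoeff D n).comp hm).aestronglyMeasurable)
      (hi.abs.const_mul _)
      (fun n => ae_of_all _ fun a => abs_driftCoeff_le hD0 n (h a))
      (ae_of_all _ fun a => tendsto_driftCoeff D (h a))
  obtain ⟨n, hn⟩ := (hlim.eventually_lt_const hneg).exists
  have hθ : 0 < 1 / ((n : ℝ) + 1) := by positivity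
  have ht := (hB.translate n _ hθ).and
    ((tendsto_atTop_add_const_right atTop (-(n : ℝ)) tendsto_id).eventually
      (hB.translate n _ hθ))
  obtain ⟨x₀, hx₀⟩ := eventually_atTop.1 ht
  set x₁ := max x₀ n
  have hx₁ : 0 ≤ x₁ := n.cast_nonneg.trans (le_max_right _ _)
  have hgi : Integrable (fun a => driftCoeff D n (h a)) μ :=
    Integrable.mono' (hi.abs.const_mul (3 + D))
      ((measurable_driftCoeff D n).comp hm).aestronglyMeasurable
      (ae_of_all _ fun a => abs_driftCoeff_le hD0 n (h a))
  have hadd := hB.integrable_add (φ := fun a => max (h a) 0) (by fun_prop)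
    (fun a => le_max_right _ _) hmom hx₁
  have hpos : ∀ a, 0 ≤ max (h a) 0 * B (max (h a) 0) := fun a =>
    mul_nonneg (le_max_right _ _) (hB.nonneg _)
  have hpos' : ∀ a, 0 ≤ (max (h a) 0 + x₁) * B (max (h a) 0 + x₁) := fun a =>
    mul_nonneg (add_nonneg (le_max_right _ _) hx₁) (hB.nonneg _)
  have hpos'' : ∀ a, 0 ≤ B x₁ * |driftCoeff D n (h a)| := fun a =>
    mul_nonneg (hB.nonneg _) (abs_nonneg _)
  refine ⟨fun a => driftCoeff D n (h a), fun a => D * (max (h a) 0 * B (max (h a) 0)) +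
    (max (h a) 0 + x₁) * B (max (h a) 0 + x₁) + B x₁ * |driftCoeff D n (h a)|,
    hgi, hn, ((hmom.const_mul D).add hadd).add (hgi.abs.const_mul _), fun x a hx => ?_⟩
  rcases le_total x₁ x with hxx | hxx
  · have h1 := hx₀ x ((le_max_left _ _).trans hxx)
    have h2 := h1.2
    simp only [id, ← sub_eq_add_neg, sub_add_cancel] at h2
    have h3 := hB.primitive_sub_le_of_large hD1 hD n ((le_max_right _ _).trans hxx) h1.1
      h2 (h a)
    linarith [hpos' a, hpos'' a]
  · have h1 : primitive B (max 0 (x + h a)) ≤ primitive B (max (h a) 0 + x₁) :=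
      hB.primitive_mono (max_le (add_nonneg (le_max_right _ _) hx₁)
        (by linarith [le_max_left (h a) 0]))
    have h2 := hB.primitive_le (max (h a) 0 + x₁)
    have h3 := hB.primitive_nonneg hx
    have h4 : -(B x₁ * |driftCoeff D n (h a)|) ≤ B x * driftCoeff D n (h a) := by
      have h5 := mul_le_mul_of_nonneg_left (neg_abs_le (driftCoeff D n (h a))) (hB.nonneg x)
      have h6 := mul_le_mul_of_nonneg_right (hB.mono hxx) (abs_nonneg (driftCoeff D n (h a)))
      linarith
    have := mul_nonneg hD0 (hpos a)
    linarith

/-! ### Sequences of pairs and their laws -/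

/-- The product `Πₙ` of the first `n` factors `M` of a sequence of pairs `(M, Q)`. -/
def partialProd (n : ℕ) (s : ℕ → ℝ × ℝ) : ℝ := ∏ i ∈ Finset.range n, (s i).1

/-- The sum of the first `n` terms `Πₖ Qₖ`. -/
def partialSum (n : ℕ) (s : ℕ → ℝ × ℝ) : ℝ := ∑ k ∈ Finset.range n, partialProd k s * (s k).2

/-- The perpetuity `∑ Πₖ Qₖ` as a function of the sequence of pairs; it has the junk value `0` when
the series does not converge absolutely. -/
noncomputable def perpetuity (s : ℕ → ℝ × ℝ) : ℝ := ∑' k, partialProd k s * (s k).2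

/-- The sequence without its first `n` terms. -/
def shift (n : ℕ) (s : ℕ → ℝ × ℝ) : ℕ → ℝ × ℝ := fun k => s (n + k)

/-- The first `n` terms of `u`, followed by all of `v`. -/
def glue (n : ℕ) (u v : ℕ → ℝ × ℝ) : ℕ → ℝ × ℝ := fun k => if k < n then u k else v (k - n)

@[fun_prop]
theorem measurable_partialProd (n : ℕ) : Measurable (partialProd n) := by
  unfold partialProd; fun_prop

@[fun_prop]
theorem measurable_partialSum (n : ℕ) : Measurable (partialSum n) := by
  unfold partialSum; fun_prop

@[fun_prop]
theorem measurable_perpetuity : Measurable perpetuity :=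
  Measurable.tsum fun k => by fun_prop

@[fun_prop]
theorem measurable_shift (n : ℕ) : Measurable (shift n) := by
  unfold shift; fun_prop

@[fun_prop]
theorem measurable_glue (n : ℕ) :
    Measurable (fun p : (ℕ → ℝ × ℝ) × (ℕ → ℝ × ℝ) => glue n p.1 p.2) := by
  unfold glue
  refine measurable_pi_lambda _ fun k => ?_
  by_cases h : k < n <;> simp only [h, if_true, if_false] <;> fun_prop

theorem glue_of_lt {n k : ℕ} (h : k < n) (u v : ℕ → ℝ × ℝ) : glue n u v k = u k := by
  simp [glue, h]

theorem glue_add (n k : ℕ) (u v : ℕ → ℝ × ℝ) : glue n u v (k + n) = v k := by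
  simp [glue]

theorem shift_glue (n : ℕ) (u v : ℕ → ℝ × ℝ) : shift n (glue n u v) = v := by
  funext k
  simp [shift, glue]

theorem partialProd_glue {n k : ℕ} (h : k ≤ n) (u v : ℕ → ℝ × ℝ) :
    partialProd k (glue n u v) = partialProd k u :=
  Finset.prod_congr rfl fun i hi => by rw [glue_of_lt ((Finset.mem_range.1 hi).trans_le h)]

theorem partialSum_glue {n k : ℕ} (h : k ≤ n) (u v : ℕ → ℝ × ℝ) :
    partialSum k (glue n u v) = partialSum k u :=
  Finset.sum_congr rfl fun i hi => by
    have hi' := Finset.mem_range.1 hi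
    rw [glue_of_lt (hi'.trans_le h), partialProd_glue (hi'.le.trans h)]

theorem partialProd_add (n k : ℕ) (s : ℕ → ℝ × ℝ) :
    partialProd (k + n) s = partialProd n s * partialProd k (shift n s) := by
  rw [add_comm]
  exact Finset.prod_range_add _ n k

theorem partialProd_succ (n : ℕ) (s : ℕ → ℝ × ℝ) :
    partialProd (n + 1) s = partialProd n s * (s n).1 := Finset.prod_range_succ _ n

theorem partialSum_succ (n : ℕ) (s : ℕ → ℝ × ℝ) :
    partialSum (n + 1) s = partialSum n s + partialProd n s * (s n).2 :=
  Finset.sum_range_succ _ n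

theorem partialProd_glue_add (n k : ℕ) (u v : ℕ → ℝ × ℝ) :
    partialProd (k + n) (glue n u v) = partialProd n u * partialProd k v := by
  rw [partialProd_add, shift_glue, partialProd_glue le_rfl]

theorem partialSum_succ_eq (n : ℕ) (s : ℕ → ℝ × ℝ) :
    partialSum (n + 1) s = (s 0).2 + (s 0).1 * partialSum n (shift 1 s) := by
  unfold partialSum
  rw [Finset.sum_range_succ', Finset.mul_sum, add_comm]
  congr 1
  · simp [partialProd]
  · refine Finset.sum_congr rfl fun k _ => ?_
    rw [partialProd_add, show shift 1 s k = s (k + 1) by rw [add_comm]; rfl, ← mul_assoc]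
    simp [partialProd]

/-- The decomposition of the series at time `n`. -/
theorem perpetuity_glue (n : ℕ) (u : ℕ → ℝ × ℝ) {v : ℕ → ℝ × ℝ}
    (hv : Summable fun k => partialProd k v * (v k).2) :
    perpetuity (glue n u v) = partialSum n u + partialProd n u * perpetuity v := by
  have hterm : ∀ k, partialProd (k + n) (glue n u v) * (glue n u v (k + n)).2 =
      partialProd n u * (partialProd k v * (v k).2) := fun k => by
    rw [partialProd_glue_add, glue_add, mul_assoc]
  have hsum : Summable fun k => partialProd k (glue n u v) * (glue n u v k).2 := by
    rw [← summable_nat_add_iff n]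
    simpa only [hterm] using hv.mul_left _
  unfold perpetuity
  rw [← hsum.sum_add_tsum_nat_add n]
  simp only [hterm]
  rw [tsum_mul_left, ← partialSum_glue le_rfl u v]
  rfl

section Law

variable (ρ : Measure (ℝ × ℝ))

/-- The law of an i.i.d. sequence with one-dimensional marginal `ρ`. -/
noncomputable abbrev iidLaw : Measure (ℕ → ℝ × ℝ) := Measure.infinitePi fun _ => ρ

variable [IsProbabilityMeasure ρ]

/-- An i.i.d. sequence may be built from the first `n` terms of one such sequence followed by an
independent one. All uses of independence go through this identity. -/
theorem measurePreserving_glue (n : ℕ) :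
    MeasurePreserving (fun p : (ℕ → ℝ × ℝ) × (ℕ → ℝ × ℝ) => glue n p.1 p.2)
      ((iidLaw ρ).prod (iidLaw ρ)) (iidLaw ρ) := by
  refine ⟨measurable_glue n, Measure.eq_infinitePi _ fun S t ht => ?_⟩
  rw [Measure.map_apply (measurable_glue n)
    (MeasurableSet.pi S.countable_toSet fun i _ => ht i)]
  have hset : (fun p : (ℕ → ℝ × ℝ) × (ℕ → ℝ × ℝ) => glue n p.1 p.2) ⁻¹' (Set.pi S t) =
      (Set.pi (S.filter (· < n) : Finset ℕ) t) ×ˢ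
        (Set.pi ((S.filter (¬ · < n)).image (· - n) : Finset ℕ) fun i => t (i + n)) := by
    ext ⟨u, v⟩
    simp only [Set.mem_preimage, Set.mem_pi, Finset.mem_coe, Set.mem_prod, Finset.mem_filter,
      Finset.mem_image, glue]
    constructor
    · intro h
      refine ⟨fun i hi => by simpa [hi.2] using h i hi.1, ?_⟩
      rintro _ ⟨i, hi, rfl⟩
      simpa [hi.2, Nat.sub_add_cancel (not_lt.1 hi.2)] using h i hi.1
    · rintro ⟨h1, h2⟩ i hi
      by_cases hin : i < n
      · simpa [hin] using h1 i ⟨hi, hin⟩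
      · simpa [hin, Nat.sub_add_cancel (not_lt.1 hin)] using h2 (i - n) ⟨i, ⟨hi, hin⟩, rfl⟩
  rw [hset, Measure.prod_prod, Measure.infinitePi_pi _ fun i _ => ht i,
    Measure.infinitePi_pi _ fun i _ => ht (i + n), Finset.prod_image,
    ← Finset.prod_filter_mul_prod_filter_not S (· < n)]
  · congr 1
    refine Finset.prod_congr rfl fun i hi => ?_
    rw [Nat.sub_add_cancel (not_lt.1 (Finset.mem_filter.1 hi).2)]
  · intro i hi j hj hij
    simp only [Finset.coe_filter, Set.mem_ofPred_eq, not_lt] at hi hj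
    simp only at hij
    omega

theorem lintegral_glue (n : ℕ) {F : (ℕ → ℝ × ℝ) → ℝ≥0∞} (hF : Measurable F) :
    ∫⁻ s, F s ∂(iidLaw ρ) = ∫⁻ u, ∫⁻ v, F (glue n u v) ∂(iidLaw ρ) ∂(iidLaw ρ) := by
  rw [← (measurePreserving_glue ρ n).lintegral_comp hF]
  exact lintegral_prod _ (hF.comp (measurable_glue n)).aemeasurable

theorem measurePreserving_eval (i : ℕ) :
    MeasurePreserving (fun s : ℕ → ℝ × ℝ => s i) (iidLaw ρ) ρ :=
  measurePreserving_eval_infinitePi (fun _ => ρ) i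

theorem measurePreserving_head_tail :
    MeasurePreserving (fun s : ℕ → ℝ × ℝ => (s 0, shift 1 s)) (iidLaw ρ) (ρ.prod (iidLaw ρ)) := by
  refine ⟨by fun_prop, ?_⟩
  have h1 := (measurePreserving_eval ρ 0).prod (MeasurePreserving.id (iidLaw ρ))
  rw [← h1.map_eq]
  conv_lhs => rw [← (measurePreserving_glue ρ 1).map_eq]
  rw [Measure.map_map (by fun_prop) (measurable_glue 1)]
  congr 1
  funext p
  simp [glue_of_lt, shift_glue, Prod.map]

theorem ae_tendsto_average {f : ℝ × ℝ → ℝ} (hf : Measurable f) (hi : Integrable f ρ) :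
    ∀ᵐ s ∂(iidLaw ρ), Tendsto (fun n : ℕ => (∑ i ∈ Finset.range n, f (s i)) / n) atTop
      (𝓝 (∫ x, f x ∂ρ)) := by
  have hmp := measurePreserving_eval ρ
  have hcomp : ∀ i, Measurable fun s : ℕ → ℝ × ℝ => f (s i) := fun i => by fun_prop
  have hmap : ∀ i, (iidLaw ρ).map (fun s => f (s i)) = ρ.map f := fun i => by
    conv_rhs => rw [← (hmp i).map_eq, Measure.map_map hf (hmp i).measurable]
    rfl
  have h := strong_law_ae_real (μ := iidLaw ρ) (fun i s => f (s i))
    ((hmp 0).integrable_comp_of_integrable hi)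
    (fun i j hij => (iIndepFun_infinitePi (P := fun _ : ℕ => ρ) (X := fun _ x => f x)
      fun _ => hf).indepFun hij)
    (fun i => ⟨(hcomp i).aemeasurable, (hcomp 0).aemeasurable, by rw [hmap, hmap]⟩)
  have hint : ∫ s, f (s 0) ∂(iidLaw ρ) = ∫ x, f x ∂ρ := by
    conv_rhs => rw [← (hmp 0).map_eq,
      integral_map (hmp 0).measurable.aemeasurable
        (by rw [(hmp 0).map_eq]; exact hf.aestronglyMeasurable)]
  rwa [hint] at h

/-- Terms of an i.i.d. sequence with finite mean are of smaller order than their index. -/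
theorem ae_tendsto_div {f : ℝ × ℝ → ℝ} (hf : Measurable f) (hi : Integrable f ρ) :
    ∀ᵐ s ∂(iidLaw ρ), Tendsto (fun n : ℕ => f (s n) / n) atTop (𝓝 0) := by
  filter_upwards [ae_tendsto_average ρ hf hi] with s hs
  have h1 := (tendsto_add_atTop_iff_nat 1).2 hs
  have h2 : Tendsto (fun n : ℕ => ((n : ℝ) + 1) / n) atTop (𝓝 1) := by
    have : Tendsto (fun n : ℕ => 1 + 1 / (n : ℝ)) atTop (𝓝 1) := by
      simpa using tendsto_one_div_atTop_nhds_zero_nat.const_add (1 : ℝ)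
    refine this.congr' ?_
    filter_upwards [eventually_ne_atTop 0] with n hn
    have : (n : ℝ) ≠ 0 := by exact_mod_cast hn
    field_simp
  have h3 := (h1.mul h2).sub hs
  rw [mul_one, sub_self] at h3
  refine h3.congr' ?_
  filter_upwards [eventually_ne_atTop 0] with n hn
  have hn' : (n : ℝ) ≠ 0 := by exact_mod_cast hn
  have hn'' : (n : ℝ) + 1 ≠ 0 := by positivity
  rw [Finset.sum_range_succ]
  push_cast
  field_simp
  ring

theorem ae_ne_zero (h0 : ∀ᵐ x ∂ρ, x.1 ≠ 0) : ∀ᵐ s ∂(iidLaw ρ), ∀ i, (s i).1 ≠ 0 :=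
  ae_all_iff.2 fun i => (measurePreserving_eval ρ i).quasiMeasurePreserving.ae h0

@[fun_prop]
theorem measurable_posLog : Measurable Real.posLog := Real.continuous_posLog.measurable

theorem abs_le_exp_posLog (x : ℝ) : |x| ≤ Real.exp (Real.posLog x) := by
  rcases eq_or_ne x 0 with rfl | hx
  · simp
  · rw [← Real.log_le_iff_le_exp (abs_pos.2 hx), Real.log_abs]
    exact le_max_right _ _

theorem abs_partialProd {s : ℕ → ℝ × ℝ} (hs : ∀ i, (s i).1 ≠ 0) (n : ℕ) :
    |partialProd n s| = Real.exp (∑ i ∈ Finset.range n, Real.log |(s i).1|) := by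
  rw [Real.exp_sum, partialProd, Finset.abs_prod]
  exact Finset.prod_congr rfl fun i _ => (Real.exp_log (abs_pos.2 (hs i))).symm

variable {ρ}

/-- The products decay exponentially by the strong law, and the factors `Q` grow subexponentially,
so the series is dominated by a geometric one. -/
theorem ae_summable (h0 : ∀ᵐ x ∂ρ, x.1 ≠ 0) (hM : Integrable (fun x => Real.log |x.1|) ρ)
    (hneg : ∫ x, Real.log |x.1| ∂ρ < 0) (hQ : Integrable (fun x => Real.posLog x.2) ρ) :
    ∀ᵐ s ∂(iidLaw ρ), Summable fun k => |partialProd k s * (s k).2| := by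
  set m := ∫ x, Real.log |x.1| ∂ρ
  filter_upwards [ae_ne_zero ρ h0, ae_tendsto_average ρ (by fun_prop) hM,
    ae_tendsto_div ρ (by fun_prop) hQ] with s hs h1 h2
  refine Summable.of_norm_bounded_eventually_nat (g := fun k => Real.exp (m / 4) ^ k)
    (summable_geometric_of_lt_one (Real.exp_pos _).le (by simpa using by linarith)) ?_
  filter_upwards [h1.eventually_lt_const (by linarith : m < m / 2),
    h2.eventually_lt_const (by linarith : 0 < -(m / 4)), eventually_gt_atTop 0] with k hk1 hk2 hk
  have hk' : (0 : ℝ) < k := by exact_mod_cast hk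
  rw [div_lt_iff₀ hk'] at hk1 hk2
  rw [Real.norm_of_nonneg (abs_nonneg _), abs_mul, abs_partialProd hs, ← Real.exp_nat_mul]
  refine (mul_le_mul_of_nonneg_left (abs_le_exp_posLog _) (Real.exp_pos _).le).trans ?_
  rw [← Real.exp_add, Real.exp_le_exp]
  linarith

end Law

/-! ### Sufficiency of the moment conditions -/

section

theorem posLog_le_iff {x c : ℝ} (hc : 0 ≤ c) : Real.posLog x ≤ c ↔ |x| ≤ Real.exp c := by
  constructor
  · exact fun h => (abs_le_exp_posLog x).trans (Real.exp_le_exp.2 h)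
  · intro h
    rcases eq_or_ne x 0 with rfl | hx
    · simpa using hc
    · exact max_le hc (by rwa [← Real.log_abs, Real.log_le_iff_le_exp (abs_pos.2 hx)])

/-- The maximum of `0` and of the exponents `ε k + log |Πₖ| + log⁺ |Qₖ|` for `k < n`, defined
through the recursion that makes it a reflected random walk with immigration. -/
noncomputable def envelope (ε : ℝ) : ℕ → (ℕ → ℝ × ℝ) → ℝ
  | 0, _ => 0
  | n + 1, s => max (Real.posLog (s 0).2) (envelope ε n (shift 1 s) + (ε + Real.log |(s 0).1|))

variable {ε : ℝ}

theorem envelope_nonneg (n : ℕ) (s : ℕ → ℝ × ℝ) : 0 ≤ envelope ε n s := by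
  cases n with
  | zero => exact le_rfl
  | succ n => exact le_max_of_le_left Real.posLog_nonneg

@[fun_prop]
theorem measurable_envelope (n : ℕ) : Measurable (envelope ε n) := by
  induction n with
  | zero => exact measurable_const
  | succ n ih =>
    change Measurable fun s => max (Real.posLog (s 0).2)
      (envelope ε n (shift 1 s) + (ε + Real.log |(s 0).1|))
    fun_prop

theorem envelope_le_succ (n : ℕ) (s : ℕ → ℝ × ℝ) : envelope ε n s ≤ envelope ε (n + 1) s := by
  induction n generalizing s with
  | zero => exact envelope_nonneg 1 s
  | succ n ih => exact max_le_max le_rfl (add_le_add_left (ih _) _)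

/-- The summands of index `k` are at most `exp (Rₙ - ε k)`, where `Rₙ` is the envelope. -/
theorem abs_partialSum_le (n : ℕ) (s : ℕ → ℝ × ℝ) :
    |partialSum n s| ≤ Real.exp (envelope ε n s) * ∑ k ∈ Finset.range n, Real.exp (-ε) ^ k := by
  induction n generalizing s with
  | zero => simp [partialSum]
  | succ n ih =>
    have h1 : |(s 0).1| ≤ Real.exp (Real.log |(s 0).1|) := by
      rcases eq_or_ne (s 0).1 0 with h | h
      · simp [h]
      · exact (Real.exp_log (abs_pos.2 h)).ge
    have h2 := (abs_le_exp_posLog (s 0).2).trans (Real.exp_le_exp.2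
      (le_max_left _ (envelope ε n (shift 1 s) + (ε + Real.log |(s 0).1|))))
    have h3 := Real.exp_le_exp.2
      (le_max_right (Real.posLog (s 0).2) (envelope ε n (shift 1 s) + (ε + Real.log |(s 0).1|)))
    rw [partialSum_succ_eq, Finset.sum_range_succ']
    change _ ≤ Real.exp (max _ _) * _
    set E := Real.exp (max (Real.posLog (s 0).2)
      (envelope ε n (shift 1 s) + (ε + Real.log |(s 0).1|)))
    set T := ∑ k ∈ Finset.range n, Real.exp (-ε) ^ k
    have hT : 0 ≤ T := Finset.sum_nonneg fun _ _ => by positivity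
    have h4 : ∑ k ∈ Finset.range n, Real.exp (-ε) ^ (k + 1) = T * Real.exp (-ε) := by
      simp only [pow_succ, T, Finset.sum_mul]
    have h5 : |(s 0).1| * |partialSum n (shift 1 s)| ≤ E * (T * Real.exp (-ε)) := by
      calc |(s 0).1| * |partialSum n (shift 1 s)|
          ≤ Real.exp (Real.log |(s 0).1|) * (Real.exp (envelope ε n (shift 1 s)) * T) :=
            mul_le_mul h1 (ih _) (abs_nonneg _) (Real.exp_pos _).le
        _ = Real.exp (envelope ε n (shift 1 s) + (ε + Real.log |(s 0).1|)) *
              (T * Real.exp (-ε)) := by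
            rw [Real.exp_add, Real.exp_add, Real.exp_neg]
            field_simp
        _ ≤ _ := mul_le_mul_of_nonneg_right h3 (by positivity)
    rw [h4, pow_zero, mul_add, mul_one]
    refine (abs_add_le _ _).trans ?_
    rw [abs_mul]
    linarith

variable {ρ : Measure (ℝ × ℝ)} [IsProbabilityMeasure ρ] {B : ℝ → ℝ}

/-- One step of the recursion for `envelope` in terms of the Lyapunov function `primitive B`. -/
theorem integral_primitive_envelope_succ (hB : IsGauge B) {g G : ℝ × ℝ → ℝ}
    (hgi : Integrable g ρ) (hGi : Integrable G ρ)
    (hdrift : ∀ x a, 0 ≤ x →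
      primitive B (max 0 (x + (ε + Real.log |a.1|))) - primitive B x ≤ B x * g a + G a)
    (hVQ : Integrable (fun x => primitive B (Real.posLog x.2)) ρ) (n : ℕ)
    (hV : Integrable (fun s => primitive B (envelope ε n s)) (iidLaw ρ))
    (hBi : Integrable (fun s => B (envelope ε n s)) (iidLaw ρ)) :
    Integrable (fun s => primitive B (envelope ε (n + 1) s)) (iidLaw ρ) ∧
    ∫ s, primitive B (envelope ε (n + 1) s) ∂(iidLaw ρ) ≤
      ∫ s, primitive B (envelope ε n s) ∂(iidLaw ρ) +
      (∫ s, B (envelope ε n s) ∂(iidLaw ρ)) * ∫ x, g x ∂ρ +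
      (∫ x, G x ∂ρ + ∫ x, primitive B (Real.posLog x.2) ∂ρ) := by
  have hVm : Measurable (primitive B) := hB.primitive_mono.measurable
  set ν := iidLaw ρ
  set F : (ℝ × ℝ) × (ℕ → ℝ × ℝ) → ℝ := fun p => primitive B
    (max (Real.posLog p.1.2) (envelope ε n p.2 + (ε + Real.log |p.1.1|)))
  set U : (ℝ × ℝ) × (ℕ → ℝ × ℝ) → ℝ := fun p =>
    (primitive B (envelope ε n p.2) + g p.1 * B (envelope ε n p.2)) +
      (G p.1 + primitive B (Real.posLog p.1.2))
  have hFm : Measurable F := by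
    refine hVm.comp ?_
    fun_prop
  have hF0 : ∀ p, 0 ≤ F p := fun p =>
    hB.primitive_nonneg (le_max_of_le_left Real.posLog_nonneg)
  have hFU : ∀ p, F p ≤ U p := by
    intro p
    have h1 := hdrift (envelope ε n p.2) p.1 (envelope_nonneg n p.2)
    have h2 : F p ≤ primitive B (Real.posLog p.1.2) +
        primitive B (max 0 (envelope ε n p.2 + (ε + Real.log |p.1.1|))) := by
      simp only [F]
      rcases le_total (Real.posLog p.1.2) (envelope ε n p.2 + (ε + Real.log |p.1.1|)) with h | h
      · rw [max_eq_right h, max_eq_right ((Real.posLog_nonneg).trans h)]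
        linarith [hB.primitive_nonneg (Real.posLog_nonneg (x := p.1.2))]
      · rw [max_eq_left h]
        linarith [hB.primitive_nonneg
          (le_max_left 0 (envelope ε n p.2 + (ε + Real.log |p.1.1|)))]
    simp only [U]
    linarith
  have hi1 : Integrable (fun p : (ℝ × ℝ) × (ℕ → ℝ × ℝ) => primitive B (envelope ε n p.2))
      (ρ.prod ν) := hV.comp_snd ρ
  have hi2 : Integrable (fun p : (ℝ × ℝ) × (ℕ → ℝ × ℝ) => g p.1 * B (envelope ε n p.2))
      (ρ.prod ν) := hgi.mul_prod hBi
  have hi3 : Integrable (fun p : (ℝ × ℝ) × (ℕ → ℝ × ℝ) => G p.1) (ρ.prod ν) := hGi.comp_fst ν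
  have hi4 : Integrable (fun p : (ℝ × ℝ) × (ℕ → ℝ × ℝ) => primitive B (Real.posLog p.1.2))
      (ρ.prod ν) := hVQ.comp_fst ν
  have hi12 : Integrable (fun p : (ℝ × ℝ) × (ℕ → ℝ × ℝ) =>
      primitive B (envelope ε n p.2) + g p.1 * B (envelope ε n p.2)) (ρ.prod ν) := hi1.add hi2
  have hi34 : Integrable (fun p : (ℝ × ℝ) × (ℕ → ℝ × ℝ) =>
      G p.1 + primitive B (Real.posLog p.1.2)) (ρ.prod ν) := hi3.add hi4
  have hU : Integrable U (ρ.prod ν) := hi12.add hi34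
  have hF : Integrable F (ρ.prod ν) := by
    refine Integrable.mono' hU hFm.aestronglyMeasurable (ae_of_all _ fun p => ?_)
    rw [Real.norm_of_nonneg (hF0 p)]
    exact hFU p
  have hmp := measurePreserving_head_tail ρ
  refine ⟨hmp.integrable_comp_of_integrable hF, ?_⟩
  have hint : ∫ s, primitive B (envelope ε (n + 1) s) ∂ν = ∫ p, F p ∂(ρ.prod ν) := by
    have hFs : AEStronglyMeasurable F (ν.map fun s => (s 0, shift 1 s)) :=
      hFm.aestronglyMeasurable
    have h1 := integral_map hmp.measurable.aemeasurable hFs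
    rw [hmp.map_eq] at h1
    exact h1.symm
  have e1 : ∫ p, primitive B (envelope ε n p.2) ∂(ρ.prod ν) =
      ∫ s, primitive B (envelope ε n s) ∂ν := by
    simpa using integral_fun_snd (μ := ρ) (ν := ν) fun s => primitive B (envelope ε n s)
  have e3 : ∫ p, G p.1 ∂(ρ.prod ν) = ∫ x, G x ∂ρ := by
    simpa using integral_fun_fst (μ := ρ) (ν := ν) G
  have e4 : ∫ p, primitive B (Real.posLog p.1.2) ∂(ρ.prod ν) =
      ∫ x, primitive B (Real.posLog x.2) ∂ρ := by
    simpa using integral_fun_fst (μ := ρ) (ν := ν) fun x => primitive B (Real.posLog x.2)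
  have e2 : ∫ p, g p.1 * B (envelope ε n p.2) ∂(ρ.prod ν) =
      (∫ s, B (envelope ε n s) ∂ν) * ∫ x, g x ∂ρ := by
    rw [mul_comm]
    exact integral_prod_mul g fun s => B (envelope ε n s)
  rw [hint, ← e1, ← e2, ← e3, ← e4, ← integral_add hi1 hi2, ← integral_add hi3 hi4,
    ← integral_add hi12 hi34]
  exact integral_mono hF hU hFU

/-- Foster's argument: summing the drift inequality bounds the averages of `E B(Rₙ)`, where `Rₙ` is
the envelope, and these expectations increase in `n`. -/
theorem exists_integral_envelope_le (hB : IsGauge B) (hε : 0 ≤ ε)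
    (hM : Integrable (fun x => Real.log |x.1|) ρ) (hneg : ε + ∫ x, Real.log |x.1| ∂ρ < 0)
    (hMB : Integrable (fun x => Real.posLog x.1 * B (Real.posLog x.1)) ρ)
    (hQB : Integrable (fun x => Real.posLog x.2 * B (Real.posLog x.2)) ρ) :
    ∃ K, ∀ n, Integrable (fun s => B (envelope ε n s)) (iidLaw ρ) ∧
      ∫ s, B (envelope ε n s) ∂(iidLaw ρ) ≤ K := by
  have hBm := hB.mono.measurable
  have hVm : Measurable (primitive B) := hB.primitive_mono.measurable
  have hmom : Integrable (fun x : ℝ × ℝ => max (ε + Real.log |x.1|) 0 *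
      B (max (ε + Real.log |x.1|) 0)) ρ := by
    refine Integrable.mono' (hB.integrable_add (by fun_prop) (fun _ => Real.posLog_nonneg) hMB hε)
      (by fun_prop : Measurable _).aestronglyMeasurable (ae_of_all _ fun x => ?_)
    rw [Real.norm_of_nonneg (mul_nonneg (le_max_right _ _) (hB.nonneg _))]
    have h1 : max (ε + Real.log |x.1|) 0 ≤ Real.posLog x.1 + ε := by
      refine max_le ?_ (add_nonneg Real.posLog_nonneg hε)
      rw [Real.log_abs, add_comm]
      exact add_le_add_left (le_max_right _ _) _
    exact mul_le_mul h1 (hB.mono h1) (hB.nonneg _) (add_nonneg Real.posLog_nonneg hε)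
  obtain ⟨g, G, hgi, hg, hGi, hdrift⟩ := hB.exists_drift
    (h := fun x : ℝ × ℝ => ε + Real.log |x.1|) (by fun_prop) ((integrable_const ε).add hM)
    (by rw [integral_add (integrable_const ε) hM]; simpa using hneg) hmom
  have hVQ : Integrable (fun x => primitive B (Real.posLog x.2)) ρ := by
    refine Integrable.mono' hQB (by fun_prop : Measurable _).aestronglyMeasurable
      (ae_of_all _ fun x => ?_)
    rw [Real.norm_of_nonneg (hB.primitive_nonneg Real.posLog_nonneg)]
    exact hB.primitive_le _
  obtain ⟨C, hC0, hC⟩ := hB.exists_le_primitive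
  have hBV : ∀ n, Integrable (fun s => primitive B (envelope ε n s)) (iidLaw ρ) →
      Integrable (fun s => B (envelope ε n s)) (iidLaw ρ) := fun n hn => by
    refine Integrable.mono' (((integrable_const 1).add hn).const_mul C)
      (by fun_prop : Measurable _).aestronglyMeasurable (ae_of_all _ fun s => ?_)
    rw [Real.norm_of_nonneg (hB.nonneg _)]
    exact hC _ (envelope_nonneg n s)
  have hVi : ∀ n, Integrable (fun s => primitive B (envelope ε n s)) (iidLaw ρ) := by
    intro n
    induction n with
    | zero => exact integrable_const (primitive B 0)
    | succ n ih =>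
      exact (integral_primitive_envelope_succ hB hgi hGi hdrift hVQ n ih (hBV n ih)).1
  set v := fun n => ∫ s, primitive B (envelope ε n s) ∂(iidLaw ρ)
  set w := fun n => ∫ s, B (envelope ε n s) ∂(iidLaw ρ)
  set γ := ∫ x, g x ∂ρ
  set H := ∫ x, G x ∂ρ + ∫ x, primitive B (Real.posLog x.2) ∂ρ
  have hstep : ∀ n, v (n + 1) ≤ v n + w n * γ + H := fun n =>
    (integral_primitive_envelope_succ hB hgi hGi hdrift hVQ n (hVi n) (hBV n (hVi n))).2
  have hv0 : ∀ n, 0 ≤ v n := fun n =>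
    integral_nonneg fun s => hB.primitive_nonneg (envelope_nonneg n s)
  have hw0 : ∀ n, 0 ≤ w n := fun n => integral_nonneg fun s => hB.nonneg _
  have hwmono : Monotone w := monotone_nat_of_le_succ fun n =>
    integral_mono (hBV n (hVi n)) (hBV (n + 1) (hVi (n + 1)))
      fun s => hB.mono (envelope_le_succ n s)
  have hsum : ∀ n : ℕ, v n + (-γ) * ∑ k ∈ Finset.range n, w k ≤ n * H := by
    intro n
    induction n with
    | zero => simp [v, envelope, IsGauge.primitive_zero]
    | succ n ih =>
      rw [Finset.sum_range_succ]
      push_cast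
      linarith [hstep n]
  refine ⟨2 * H / (-γ), fun n => ⟨hBV n (hVi n), ?_⟩⟩
  refine (hwmono n.le_succ).trans ?_
  rw [le_div_iff₀ (by linarith)]
  set m := n + 1
  have hm : (0 : ℝ) < m := by positivity
  -- by monotonicity, `w m` is at most the average of `w` over `[m, 2m)`
  have h1 : (m : ℝ) * w m ≤ ∑ k ∈ Finset.range (m + m), w k := by
    rw [Finset.sum_range_add]
    have h2 : ∑ _k ∈ Finset.range m, w m ≤ ∑ k ∈ Finset.range m, w (m + k) :=
      Finset.sum_le_sum fun k _ => hwmono (Nat.le_add_right m k)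
    rw [Finset.sum_const, Finset.card_range, nsmul_eq_mul] at h2
    linarith [Finset.sum_nonneg fun k (_ : k ∈ Finset.range m) => hw0 k]
  have h3 := hsum (m + m)
  have h4 := mul_le_mul_of_nonneg_left h1 (by linarith : 0 ≤ -γ)
  push_cast at h3
  have h5 : m * (w m * -γ) ≤ m * (2 * H) := by linarith [hv0 (m + m)]
  exact le_of_mul_le_mul_left h5 hm

/-- The direct moment estimate. The tilt `ε` is half the absolute drift, so that the tilted walk
still has negative drift; the limit of the partial sums is handled by Fatou's lemma. -/
theorem lintegral_perpetuity_lt_top (hB : IsGauge B) (h0 : ∀ᵐ x ∂ρ, x.1 ≠ 0)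
    (hM : Integrable (fun x => Real.log |x.1|) ρ) (hneg : ∫ x, Real.log |x.1| ∂ρ < 0)
    (hQ : Integrable (fun x => Real.posLog x.2) ρ)
    (hMB : Integrable (fun x => Real.posLog x.1 * B (Real.posLog x.1)) ρ)
    (hQB : Integrable (fun x => Real.posLog x.2 * B (Real.posLog x.2)) ρ) :
    ∫⁻ s, ENNReal.ofReal (B (Real.posLog (perpetuity s))) ∂(iidLaw ρ) < ∞ := by
  have hBm := hB.mono.measurable
  set m := ∫ x, Real.log |x.1| ∂ρ
  set ε := -(m / 2) with hεdef
  have hε : 0 < ε := by linarith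
  obtain ⟨K, hK⟩ := exists_integral_envelope_le hB hε.le hM (by linarith) hMB hQB
  obtain ⟨D, hD1, hD⟩ := hB.exists_add_le
  have hr : Real.exp (-ε) < 1 := by simpa using hε
  set c := -Real.log (1 - Real.exp (-ε))
  have hc : 0 ≤ c := by
    have := Real.log_nonpos (by linarith) (by linarith [Real.exp_pos (-ε)] :
      1 - Real.exp (-ε) ≤ 1)
    linarith
  have hA : ∀ n s, Real.posLog (partialSum n s) ≤ envelope ε n s + c := by
    intro n s
    rw [posLog_le_iff (add_nonneg (envelope_nonneg n s) hc), Real.exp_add, Real.exp_neg,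
      Real.exp_log (by linarith)]
    refine (abs_partialSum_le n s).trans (mul_le_mul_of_nonneg_left ?_ (Real.exp_pos _).le)
    rw [← tsum_geometric_of_lt_one (Real.exp_pos _).le hr]
    exact (summable_geometric_of_lt_one (Real.exp_pos _).le hr).sum_le_tsum _
      fun _ _ => by positivity
  have hle : ∀ᵐ s ∂(iidLaw ρ), ENNReal.ofReal (B (Real.posLog (perpetuity s))) ≤
      liminf (fun n => ENNReal.ofReal (D * (B (envelope ε n s) + B (c + 1)))) atTop := by
    filter_upwards [ae_summable h0 hM hneg hQ] with s hs
    have hlim : Tendsto (fun n => partialSum n s) atTop (𝓝 (perpetuity s)) :=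
      hs.of_abs.hasSum.tendsto_sum_nat
    have hlim' := ((Real.continuous_posLog.tendsto _).comp hlim).eventually_const_lt
      (sub_one_lt (Real.posLog (perpetuity s)))
    refine le_liminf_of_le ?_ ?_
    · isBoundedDefault
    filter_upwards [hlim'] with n hn
    simp only [Function.comp_apply] at hn
    -- eventually `log⁺ |Z| < log⁺ |Aₙ| + 1`, by continuity of `log⁺`
    refine ENNReal.ofReal_le_ofReal ((hB.mono ?_).trans
      (hD _ (c + 1) (envelope_nonneg n s) (by linarith)))
    linarith [hA n s]
  refine (lintegral_mono_ae hle).trans_lt ((lintegral_liminf_le fun n => by fun_prop).trans_lt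
    (lt_of_le_of_lt (b := ENNReal.ofReal (D * (K + B (c + 1)))) ?_ ENNReal.ofReal_lt_top))
  refine liminf_le_of_le ?_ fun a ha => ?_
  · isBoundedDefault
  obtain ⟨n, hn⟩ := ha.exists
  refine hn.trans ?_
  have hi : Integrable (fun s => D * (B (envelope ε n s) + B (c + 1))) (iidLaw ρ) :=
    ((hK n).1.add (integrable_const _)).const_mul D
  rw [← ofReal_integral_eq_lintegral_ofReal hi (ae_of_all _ fun s =>
    mul_nonneg (by linarith) (add_nonneg (hB.nonneg _) (hB.nonneg _)))]
  refine ENNReal.ofReal_le_ofReal ?_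
  rw [integral_const_mul, integral_add (hK n).1 (integrable_const _)]
  refine mul_le_mul_of_nonneg_left ?_ (by linarith)
  simpa using (hK n).2

end

/-! ### Anti-concentration and tame paths -/

section

/-- The law of a random variable that is not a.s. constant is not concentrated, uniformly in the
centre, near any point. -/
theorem exists_anticoncentration {α : Type*} [MeasurableSpace α] {μ : Measure α} {Z : α → ℝ}
    (h : ¬ ∃ z, ∀ᵐ s ∂μ, Z s = z) :
    ∃ δ > 0, ∃ p : ℝ≥0∞, 0 < p ∧ ∀ a, p ≤ μ {s | δ ≤ |Z s - a|} := by
  have hq : ∃ q : ℝ, μ {s | Z s ≤ q} ≠ 0 ∧ μ {s | q < Z s} ≠ 0 := by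
    by_contra! hcon
    refine h ?_
    have hsep : HasCountableSeparatingOn ℝ (· ∈ Set.range (Set.Iic : ℝ → Set ℝ)) Set.univ :=
      inferInstance
    refine exists_eventuallyEq_const_of_forall_separating (l := ae μ) (f := Z)
      (· ∈ Set.range (Set.Iic : ℝ → Set ℝ)) ?_
    rintro _ ⟨q, rfl⟩
    by_cases h0 : μ {s | Z s ≤ q} = 0
    · exact Or.inr (measure_eq_zero_iff_ae_notMem.1 h0)
    · left
      filter_upwards [measure_eq_zero_iff_ae_notMem.1 (hcon q h0)] with s hs
      simpa using hs
  obtain ⟨q, hq1, hq2⟩ := hq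
  have hU : {s | q < Z s} ⊆ ⋃ n : ℕ, {s | q + 2 * (1 / ((n : ℝ) + 1)) < Z s} := by
    intro s hs
    have hs' : 0 < (Z s - q) / 2 := by
      have : q < Z s := hs
      linarith
    obtain ⟨n, hn⟩ := exists_nat_one_div_lt hs'
    exact Set.mem_iUnion.2 ⟨n, by
      change q + 2 * (1 / ((n : ℝ) + 1)) < Z s
      linarith⟩
  have hne : ∃ n : ℕ, μ {s | q + 2 * (1 / ((n : ℝ) + 1)) < Z s} ≠ 0 := by
    by_contra! hcon
    exact hq2 (measure_mono_null hU (measure_iUnion_null hcon))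
  obtain ⟨n, hn⟩ := hne
  set δ := 1 / ((n : ℝ) + 1)
  refine ⟨δ, by positivity, min (μ {s | Z s ≤ q}) (μ {s | q + 2 * δ < Z s}),
    lt_min (pos_iff_ne_zero.2 hq1) (pos_iff_ne_zero.2 hn), fun a => ?_⟩
  rcases le_total (q + δ) a with ha | ha
  · refine (min_le_left _ _).trans (measure_mono fun s hs => ?_)
    have hs' : Z s ≤ q := hs
    change δ ≤ |Z s - a|
    rw [abs_sub_comm]
    exact le_abs.2 (Or.inl (by linarith))
  · refine (min_le_right _ _).trans (measure_mono fun s hs => ?_)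
    have hs' : q + 2 * δ < Z s := hs
    change δ ≤ |Z s - a|
    exact le_abs.2 (Or.inl (by linarith))

/-- An affine image `A + B Z` of a nondegenerate variable is, with a probability bounded below,
at least of the order of the larger coefficient: if `B` is large this is anti-concentration, and
otherwise `A` dominates as soon as `Z` is not too large. -/
theorem exists_affine_lower_bound {α : Type*} [MeasurableSpace α] {μ : Measure α}
    [IsProbabilityMeasure μ] {Z : α → ℝ} (h : ¬ ∃ z, ∀ᵐ s ∂μ, Z s = z) :
    ∃ C : ℝ, 1 ≤ C ∧ ∃ p : ℝ≥0∞, 0 < p ∧ ∀ A B y : ℝ, y ≤ max |A| |B| →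
      p ≤ μ {s | y ≤ C * |A + B * Z s|} := by
  obtain ⟨δ, hδ, p, hp, hanti⟩ := exists_anticoncentration h
  have hR : ∃ R : ℕ, μ {s | |Z s| ≤ R} ≠ 0 := by
    by_contra! hcon
    have hU : (Set.univ : Set α) ⊆ ⋃ R : ℕ, {s | |Z s| ≤ R} := fun s _ =>
      Set.mem_iUnion.2 (exists_nat_ge |Z s|)
    have h1 := measure_mono_null hU (measure_iUnion_null hcon)
    simp at h1
  obtain ⟨R, hR⟩ := hR
  have hR0 : (0 : ℝ) ≤ R := R.cast_nonneg
  set C := 1 + ((R : ℝ) + 1) / δ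
  have hC1 : 1 ≤ C := le_add_of_nonneg_right (by positivity)
  have hCδ : C * δ = δ + R + 1 := by
    simp only [C]; field_simp; ring
  refine ⟨C, hC1, min p (μ {s | |Z s| ≤ R}), lt_min hp (pos_iff_ne_zero.2 hR),
    fun A B y hy => ?_⟩
  rcases le_total y (C * (δ * |B|)) with h1 | h1
  · refine (min_le_left _ _).trans ((hanti (-A / B)).trans (measure_mono fun s hs => ?_))
    refine h1.trans (mul_le_mul_of_nonneg_left ?_ (by linarith))
    rcases eq_or_ne B 0 with rfl | hB
    · simp
    · have hs' : δ ≤ |Z s - -A / B| := hs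
      calc δ * |B| ≤ |Z s - -A / B| * |B| := mul_le_mul_of_nonneg_right hs' (abs_nonneg _)
        _ = |A + B * Z s| := by
          rw [← abs_mul]
          congr 1
          field_simp
          ring
  · refine (min_le_right _ _).trans (measure_mono fun s hs => ?_)
    have hs' : |Z s| ≤ R := hs
    have hB0 := abs_nonneg B
    have h2 : (δ + R + 1) * |B| ≤ y := by
      rw [← hCδ]; linarith
    have hA : y ≤ |A| := by
      rcases le_max_iff.1 hy with h3 | h3
      · exact h3
      · have h4 : (δ + R) * |B| ≤ 0 := by linarith
        have h5 : |B| ≤ 0 := by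
          by_contra hc
          have : 0 < (δ + R) * |B| := mul_pos (by linarith) (not_le.1 hc)
          linarith
        exact h3.trans (h5.trans (abs_nonneg A))
    have h3 : |A| ≤ |A + B * Z s| + |B| * R := by
      have h4 : |A| ≤ |A + B * Z s| + |B * Z s| := by
        have := abs_sub (A + B * Z s) (B * Z s)
        rwa [add_sub_cancel_right] at this
      rw [abs_mul] at h4
      linarith [mul_le_mul_of_nonneg_left hs' hB0]
    change y ≤ C * |A + B * Z s|
    -- `C (y - R |B|) ≥ y` because `C δ |B| ≤ y`
    have h5 : C * (|B| * R) * δ ≤ (C - 1) * y * δ := by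
      have h6 : (C - 1) * δ = R + 1 := by linarith
      calc C * (|B| * R) * δ = (C * (δ * |B|)) * R := by ring
        _ ≤ y * R := mul_le_mul_of_nonneg_right h1 hR0
        _ ≤ y * (R + 1) := by
          have : 0 ≤ y := le_trans (by positivity) h2
          linarith
        _ = (C - 1) * y * δ := by rw [← h6]; ring
    have h7 := le_of_mul_le_mul_right h5 hδ
    have h8 := mul_le_mul_of_nonneg_left (hA.trans h3) (by linarith : 0 ≤ C)
    linarith

variable {ρ : Measure (ℝ × ℝ)} [IsProbabilityMeasure ρ] {B : ℝ → ℝ}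

/-- With probability close to one the products decay at most exponentially and the partial sums
stay bounded. -/
theorem exists_tame (h0 : ∀ᵐ x ∂ρ, x.1 ≠ 0) (hM : Integrable (fun x => Real.log |x.1|) ρ)
    (hneg : ∫ x, Real.log |x.1| ∂ρ < 0) (hQ : Integrable (fun x => Real.posLog x.2) ρ) :
    ∃ a > 0, ∃ L : ℝ, 0 ≤ L ∧ ENNReal.ofReal (3 / 4) < iidLaw ρ {s | ∀ n : ℕ,
      Real.exp (-(a * n) - L) ≤ |partialProd n s| ∧ |partialSum n s| ≤ L} := by
  set m := ∫ x, Real.log |x.1| ∂ρ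
  have ha : 0 < 1 - m := by linarith
  set S : ℕ → Set (ℕ → ℝ × ℝ) := fun L => {s | ∀ n : ℕ,
      Real.exp (-((1 - m) * n) - L) ≤ |partialProd n s| ∧ |partialSum n s| ≤ L}
  have hmono : Monotone S := fun L L' hL s hs n => by
    have hL' : (L : ℝ) ≤ L' := by exact_mod_cast hL
    exact ⟨(Real.exp_le_exp.2 (by linarith)).trans (hs n).1, (hs n).2.trans hL'⟩
  have hae : ∀ᵐ s ∂(iidLaw ρ), s ∈ ⋃ L, S L := by
    filter_upwards [ae_ne_zero ρ h0, ae_tendsto_average ρ (by fun_prop) hM,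
      ae_summable h0 hM hneg hQ] with s hs h1 h2
    have hlim : Tendsto (fun n => partialSum n s) atTop (𝓝 (perpetuity s)) :=
      h2.of_abs.hasSum.tendsto_sum_nat
    obtain ⟨K₁, hK₁⟩ := hlim.abs.bddAbove_range
    have h3 : ∀ᶠ n : ℕ in atTop,
        -((1 - m) * n) - ∑ i ∈ Finset.range n, Real.log |(s i).1| ≤ 0 := by
      filter_upwards [h1.eventually_const_lt (by linarith : m - 1 < m), eventually_gt_atTop 0]
        with n hn hn0
      rw [lt_div_iff₀ (by exact_mod_cast hn0)] at hn
      linarith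
    obtain ⟨K₂, hK₂⟩ := (isBoundedUnder_of_eventually_le h3).bddAbove_range
    obtain ⟨L, hL⟩ := exists_nat_ge (max K₁ K₂)
    refine Set.mem_iUnion.2 ⟨L, fun n => ⟨?_, ?_⟩⟩
    · rw [abs_partialProd hs, Real.exp_le_exp]
      have := hK₂ ⟨n, rfl⟩
      simp only at this
      linarith [le_max_right K₁ K₂]
    · exact (hK₁ ⟨n, rfl⟩).trans ((le_max_left _ _).trans hL)
  have hlim := tendsto_measure_iUnion_atTop (μ := iidLaw ρ) hmono
  have hone : iidLaw ρ (⋃ L, S L) = 1 :=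
    (measure_congr (eventuallyEq_univ.2 hae)).trans measure_univ
  rw [hone] at hlim
  obtain ⟨L, hL⟩ := (hlim.eventually_const_lt (u := ENNReal.ofReal (3 / 4))
    (by rw [ENNReal.ofReal_lt_one]; norm_num)).exists
  exact ⟨1 - m, ha, L, L.cast_nonneg, hL⟩

/-- For an integrable `η`, raising a linear boundary makes the total probability of exceeding it
small. -/
theorem exists_tsum_tail_le {η : ℝ × ℝ → ℝ} (hη0 : ∀ x, 0 ≤ η x)
    (hi : Integrable η ρ) {a : ℝ} (ha : 0 < a) (c : ℝ) :
    ∃ x₀, c ≤ x₀ ∧ ∑' n : ℕ, ρ {x | x₀ + a * n < η x} ≤ ENNReal.ofReal (1 / 4) := by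
  have hfin : ∑' n : ℕ, ρ {x | (n : ℝ) < η x / a} < ∞ := by
    let _ : MeasureSpace (ℝ × ℝ) := ⟨ρ⟩
    have : IsProbabilityMeasure (volume : Measure (ℝ × ℝ)) := ‹IsProbabilityMeasure ρ›
    exact tsum_prob_mem_Ioi_lt_top (X := fun x => η x / a) (hi.div_const a)
      fun x => div_nonneg (hη0 x) ha.le
  have hlim := (ENNReal.tendsto_sum_nat_add (fun n : ℕ => ρ {x | (n : ℝ) < η x / a})
    hfin.ne).eventually_le_const (u := ENNReal.ofReal (1 / 4)) (by simp)
  obtain ⟨N, hN1, hN2⟩ := (hlim.and (eventually_ge_atTop ⌈c / a⌉₊)).exists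
  refine ⟨a * N, ?_, le_trans (le_of_eq (tsum_congr fun n => ?_)) hN1⟩
  · rw [← div_le_iff₀' ha]
    exact Nat.ceil_le.1 hN2
  · congr 1
    ext x
    change a * N + a * n < η x ↔ ((n + N : ℕ) : ℝ) < η x / a
    rw [lt_div_iff₀ ha]
    push_cast
    constructor <;> intro h <;> linarith

/-- Summing a gauge along an arithmetic progression gains one power. -/
theorem IsGauge.exists_mul_le_tsum (hB : IsGauge B) {a : ℝ} (ha : 0 < a) (x₀ L : ℝ) :
    ∃ K₁ K₂ : ℝ≥0∞, K₁ ≠ ∞ ∧ K₂ ≠ ∞ ∧ ∀ z : ℝ, 0 ≤ z → ENNReal.ofReal (z * B z) ≤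
      K₁ + K₂ * ∑' n : ℕ, if x₀ + a * n < z then ENNReal.ofReal (B (z - a * n - L)) else 0 := by
  obtain ⟨D, hD1, hD⟩ := hB.exists_doubling
  set z₀ := 1 + 4 * |x₀| + 4 * |L|
  have hx0 := le_abs_self x₀
  have hL := le_abs_self L
  have hx0' := abs_nonneg x₀
  have hL' := abs_nonneg L
  refine ⟨ENNReal.ofReal (z₀ * B z₀), ENNReal.ofReal (4 * a * D), ENNReal.ofReal_ne_top,
    ENNReal.ofReal_ne_top, fun z hz => ?_⟩
  rcases le_total z z₀ with h | h
  · refine le_add_right (ENNReal.ofReal_le_ofReal ?_)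
    exact mul_le_mul h (hB.mono h) (hB.nonneg _) (by positivity)
  · refine le_add_left ?_
    set N := ⌊z / (4 * a)⌋₊ + 1
    have hN : z / (4 * a) ≤ (N : ℝ) := by
      simp only [N]; push_cast; exact (Nat.lt_floor_add_one _).le
    -- each of the first `N ≥ z / (4 a)` terms is at least `B (z / 2)`
    have hterm : ∀ n ∈ Finset.range N, ENNReal.ofReal (B (z / 2)) ≤
        if x₀ + a * n < z then ENNReal.ofReal (B (z - a * n - L)) else 0 := by
      intro n hn
      have hn1 : n ≤ ⌊z / (4 * a)⌋₊ := Nat.lt_succ_iff.1 (Finset.mem_range.1 hn)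
      have hn2 : (n : ℝ) ≤ z / (4 * a) := (Nat.le_floor_iff (by positivity)).1 hn1
      rw [le_div_iff₀ (by positivity)] at hn2
      rw [if_pos (by linarith)]
      exact ENNReal.ofReal_le_ofReal (hB.mono (by linarith))
    have h1 := (Finset.sum_le_sum hterm).trans (ENNReal.sum_le_tsum _)
    rw [Finset.sum_const, Finset.card_range, nsmul_eq_mul, ← ENNReal.ofReal_natCast,
      ← ENNReal.ofReal_mul N.cast_nonneg] at h1
    refine le_trans ?_ (mul_le_mul_right h1 _)
    rw [← ENNReal.ofReal_mul (by positivity)]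
    refine ENNReal.ofReal_le_ofReal ?_
    have h2 := hD (z / 2) (by linarith)
    rw [mul_div_cancel₀ z two_ne_zero] at h2
    rw [div_le_iff₀ (by positivity)] at hN
    have h3 := mul_le_mul hN h2 (hB.nonneg _) (by positivity)
    linarith

end

/-! ### Necessity of the moment conditions -/

section

variable {ρ : Measure (ℝ × ℝ)} [IsProbabilityMeasure ρ] {B : ℝ → ℝ}

/-- The event that the path is tame at time `n` (with parameters `a`, `L`) and that no earlier term
has visited the sets `E j`. It depends on the first `n` terms only. -/
def quietUntil (a L : ℝ) (E : ℕ → Set (ℝ × ℝ)) (n : ℕ) : Set (ℕ → ℝ × ℝ) :=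
  {s | (∀ j < n, s j ∉ E j) ∧ Real.exp (-(a * n) - L) ≤ |partialProd n s| ∧ |partialSum n s| ≤ L}

section quietUntil

variable {a L : ℝ} {E : ℕ → Set (ℝ × ℝ)}

theorem measurableSet_quietUntil (hE : ∀ n, MeasurableSet (E n)) (n : ℕ) :
    MeasurableSet (quietUntil a L E n) := by
  have h1 : MeasurableSet {s : ℕ → ℝ × ℝ | ∀ j < n, s j ∉ E j} := by
    have : {s : ℕ → ℝ × ℝ | ∀ j < n, s j ∉ E j} =
        ⋂ j, ⋂ (_ : j < n), (fun s : ℕ → ℝ × ℝ => s j) ⁻¹' (E j)ᶜ := by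
      ext s; simp
    rw [this]
    exact MeasurableSet.iInter fun j => MeasurableSet.iInter fun _ =>
      (measurable_pi_apply j) (hE j).compl
  have h2 : MeasurableSet {s : ℕ → ℝ × ℝ | Real.exp (-(a * n) - L) ≤ |partialProd n s|} :=
    measurableSet_le measurable_const (by fun_prop)
  have h3 : MeasurableSet {s : ℕ → ℝ × ℝ | |partialSum n s| ≤ L} :=
    measurableSet_le (by fun_prop) measurable_const
  exact h1.inter (h2.inter h3)

theorem glue_mem_quietUntil {n k : ℕ} (h : k ≤ n) (u v : ℕ → ℝ × ℝ) :
    glue n u v ∈ quietUntil a L E k ↔ u ∈ quietUntil a L E k := by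
  have h1 : (∀ j < k, glue n u v j ∉ E j) ↔ ∀ j < k, u j ∉ E j :=
    forall₂_congr fun j hj => by rw [glue_of_lt (hj.trans_le h)]
  change (_ ∧ _ ∧ _) ↔ (_ ∧ _ ∧ _)
  rw [partialProd_glue h, partialSum_glue h, h1]

theorem le_measure_quietUntil
    (htame : ENNReal.ofReal (3 / 4) < iidLaw ρ {s | ∀ n : ℕ,
      Real.exp (-(a * n) - L) ≤ |partialProd n s| ∧ |partialSum n s| ≤ L})
    (hE : ∀ n, MeasurableSet (E n)) (hsum : ∑' n, ρ (E n) ≤ ENNReal.ofReal (1 / 4)) (n : ℕ) :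
    ENNReal.ofReal (1 / 2) ≤ iidLaw ρ (quietUntil a L E n) := by
  by_contra! hcon
  set T : Set (ℕ → ℝ × ℝ) := {s | ∀ n : ℕ,
      Real.exp (-(a * n) - L) ≤ |partialProd n s| ∧ |partialSum n s| ≤ L}
  set V : Set (ℕ → ℝ × ℝ) := ⋃ j, (fun s : ℕ → ℝ × ℝ => s j) ⁻¹' E j
  have hV : iidLaw ρ V ≤ ENNReal.ofReal (1 / 4) := by
    refine (measure_iUnion_le _).trans (le_trans (le_of_eq (tsum_congr fun j => ?_)) hsum)
    exact (measurePreserving_eval ρ j).measure_preimage (hE j).nullMeasurableSet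
  have hsub : T ⊆ quietUntil a L E n ∪ V := by
    intro s hs
    by_cases hsV : s ∈ V
    · exact Or.inr hsV
    · refine Or.inl ⟨fun j _ hj => hsV (Set.mem_iUnion.2 ⟨j, hj⟩), hs n⟩
  have h1 := htame.trans_le ((measure_mono hsub).trans (measure_union_le _ _))
  have h2 := h1.trans_le (add_le_add hcon.le hV)
  rw [← ENNReal.ofReal_add (by norm_num) (by norm_num)] at h2
  norm_num at h2

theorem lintegral_indicator_quietUntil (hE : ∀ n, MeasurableSet (E n)) (n : ℕ)
    {f : ℝ × ℝ → ℝ≥0∞} (hf : Measurable f) :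
    ∫⁻ s, (quietUntil a L E n).indicator (fun s => f (s n)) s ∂(iidLaw ρ) =
      (∫⁻ x, f x ∂ρ) * iidLaw ρ (quietUntil a L E n) := by
  have hQm := measurableSet_quietUntil (a := a) (L := L) hE n
  have hm : Measurable ((quietUntil a L E n).indicator fun s : ℕ → ℝ × ℝ => f (s n)) :=
    (hf.comp (measurable_pi_apply n)).indicator hQm
  rw [lintegral_glue ρ n hm, ← lintegral_indicator_const hQm]
  refine lintegral_congr fun u => ?_
  have h1 : ∀ v, (quietUntil a L E n).indicator (fun s : ℕ → ℝ × ℝ => f (s n)) (glue n u v) =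
      (quietUntil a L E n).indicator (fun _ => f (v 0)) u := by
    intro v
    have h2 : glue n u v n = v 0 := by simpa using glue_add n 0 u v
    by_cases hu : u ∈ quietUntil a L E n
    · rw [Set.indicator_of_mem hu, Set.indicator_of_mem ((glue_mem_quietUntil le_rfl u v).2 hu), h2]
    · rw [Set.indicator_of_notMem hu,
        Set.indicator_of_notMem fun h => hu ((glue_mem_quietUntil le_rfl u v).1 h)]
  simp only [h1]
  by_cases hu : u ∈ quietUntil a L E n
  · simp only [Set.indicator_of_mem hu]
    exact (measurePreserving_eval ρ 0).lintegral_comp hf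
  · simp [Set.indicator_of_notMem hu]

end quietUntil

/-- The converse moment estimate. `Y` stands for `M` or for `Q`. The first time `n` at which
`log⁺ |Yₙ|` exceeds a linear boundary forces, on tame paths, `|Πₙ Yₙ|` to be large, hence one of
the coefficients in `Z = Aₙ₊₁ + Πₙ₊₁ Z'` is; with probability bounded below, so is `Z`.
Summing over `n` the contributions of these disjoint events gains one power of `log⁺ |Y|`. -/
theorem lintegral_mul_lt_top_of_lintegral_perpetuity (hB : IsGauge B) (h0 : ∀ᵐ x ∂ρ, x.1 ≠ 0)
    (hM : Integrable (fun x => Real.log |x.1|) ρ) (hneg : ∫ x, Real.log |x.1| ∂ρ < 0)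
    (hQ : Integrable (fun x => Real.posLog x.2) ρ)
    (hnondeg : ¬ ∃ z, ∀ᵐ s ∂(iidLaw ρ), perpetuity s = z)
    (hfin : ∫⁻ s, ENNReal.ofReal (B (Real.posLog (perpetuity s))) ∂(iidLaw ρ) < ∞)
    {Y : ℝ × ℝ → ℝ} (hY : Measurable Y) (hYi : Integrable (fun x => Real.posLog (Y x)) ρ)
    (hYle : ∀ (x : ℝ × ℝ) (A R : ℝ), |R * Y x| ≤ |A| + max |A + R * x.2| |R * x.1|) :
    ∫⁻ x, ENNReal.ofReal (Real.posLog (Y x) * B (Real.posLog (Y x))) ∂ρ < ∞ := by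
  have hBm := hB.mono.measurable
  obtain ⟨a, ha, L, hL0, htame⟩ := exists_tame h0 hM hneg hQ
  obtain ⟨C, hC1, p, hp, haff⟩ := exists_affine_lower_bound hnondeg
  -- with `x₀ ≥ 3 L` the bound `L` on partial sums is at most half of `|Πₙ Yₙ|`
  obtain ⟨x₀, hx₀, hsum⟩ := exists_tsum_tail_le (fun x => Real.posLog_nonneg) hYi ha
    (3 * L)
  have hx₀0 : 0 ≤ x₀ := by linarith
  set L' := L + Real.log (2 * C)
  set η : ℝ × ℝ → ℝ := fun x => Real.posLog (Y x)
  have hηm : Measurable η := by fun_prop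
  set E : ℕ → Set (ℝ × ℝ) := fun n => {x | x₀ + a * n < η x}
  have hE : ∀ n, MeasurableSet (E n) := fun n => measurableSet_lt measurable_const hηm
  set r : ℕ → ℝ × ℝ → ℝ≥0∞ := fun n x =>
    if x₀ + a * n < η x then ENNReal.ofReal (B (η x - a * n - L')) else 0
  have hr : ∀ n, Measurable (r n) := fun n => Measurable.ite (hE n) (by fun_prop) measurable_const
  -- the contribution of time `n`
  set W : ℕ → Set (ℕ → ℝ × ℝ) := fun n =>
    {s | η (s n) - a * n - L' ≤ Real.posLog (perpetuity s)}
  have hW : ∀ n, MeasurableSet (W n) := fun n => measurableSet_le (by fun_prop) (by fun_prop)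
  set F : ℕ → (ℕ → ℝ × ℝ) → ℝ≥0∞ := fun n =>
    (quietUntil a L E n ∩ W n).indicator fun s => r n (s n)
  have hF : ∀ n, Measurable (F n) := fun n =>
    ((hr n).comp (measurable_pi_apply n)).indicator ((measurableSet_quietUntil hE n).inter (hW n))
  have hkey : ∀ (n : ℕ) (u : ℕ → ℝ × ℝ), u ∈ quietUntil a L E n → u n ∈ E n →
      p ≤ iidLaw ρ {v | η (u n) - a * n - L' ≤
        Real.posLog (partialSum (n + 1) u + partialProd (n + 1) u * perpetuity v)} := by
    rintro n u ⟨-, hu1, hu2⟩ hun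
    have hun' : x₀ + a * n < η (u n) := hun
    have hyle := hYle (u n) (partialSum n u) (partialProd n u)
    rw [← partialSum_succ, ← partialProd_succ] at hyle
    have hη0 : 0 < η (u n) := lt_of_le_of_lt (by positivity) hun'
    have hYexp : Real.exp (η (u n)) = |Y (u n)| := by
      have h1 : η (u n) = Real.log (Y (u n)) := by
        refine max_eq_right_of_lt (lt_of_not_ge fun hle => ?_)
        have : η (u n) = 0 := max_eq_left hle
        linarith
      have h2 : Y (u n) ≠ 0 := by
        intro h3
        rw [h1, h3, Real.log_zero] at hη0
        exact lt_irrefl _ hη0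
      rw [h1, ← Real.log_abs, Real.exp_log (abs_pos.2 h2)]
    have hbig : Real.exp (η (u n) - a * n - L) ≤ |partialProd n u * Y (u n)| := by
      rw [abs_mul, ← hYexp, show η (u n) - a * n - L = (-(a * n) - L) + η (u n) by ring,
        Real.exp_add]
      exact mul_le_mul_of_nonneg_right hu1 (Real.exp_pos _).le
    have h2L : 2 * L ≤ Real.exp (η (u n) - a * n - L) := by
      have := Real.add_one_le_exp (η (u n) - a * n - L)
      linarith
    refine (haff (partialSum (n + 1) u) (partialProd (n + 1) u)
      (Real.exp (η (u n) - a * n - L) / 2) (by linarith)).trans (measure_mono fun v hv => ?_)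
    have hv' : Real.exp (η (u n) - a * n - L) / 2 ≤
      C * |partialSum (n + 1) u + partialProd (n + 1) u * perpetuity v| := hv
    change η (u n) - a * n - L' ≤
      Real.posLog (partialSum (n + 1) u + partialProd (n + 1) u * perpetuity v)
    have h3 : Real.exp (η (u n) - a * n - L') ≤
        |partialSum (n + 1) u + partialProd (n + 1) u * perpetuity v| := by
      rw [show η (u n) - a * n - L' = (η (u n) - a * n - L) - Real.log (2 * C) by
        simp only [L']; ring, Real.exp_sub, Real.exp_log (by linarith),
        div_le_iff₀ (by linarith)]
      linarith
    exact Real.exp_le_exp.1 (h3.trans (abs_le_exp_posLog _))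
  have hlower : ∀ n, p * ((∫⁻ x, r n x ∂ρ) * iidLaw ρ (quietUntil a L E n)) ≤
      ∫⁻ s, F n s ∂(iidLaw ρ) := by
    intro n
    have hm : Measurable ((quietUntil a L E n).indicator fun s => r n (s n)) :=
      ((hr n).comp (measurable_pi_apply n)).indicator (measurableSet_quietUntil hE n)
    rw [← lintegral_indicator_quietUntil hE n (hr n), ← lintegral_const_mul _ hm,
      lintegral_glue ρ (n + 1) (hF n)]
    refine lintegral_mono fun u => ?_
    by_cases hu : u ∈ quietUntil a L E n
    swap
    · simp [Set.indicator_of_notMem hu]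
    by_cases hun : u n ∈ E n
    swap
    · have : r n (u n) = 0 := if_neg hun
      simp [Set.indicator_of_mem hu, this]
    set S := {v | η (u n) - a * n - L' ≤
        Real.posLog (partialSum (n + 1) u + partialProd (n + 1) u * perpetuity v)}
    have hS : MeasurableSet S := measurableSet_le measurable_const (by fun_prop)
    have hFS : ∀ᵐ v ∂(iidLaw ρ), F n (glue (n + 1) u v) = S.indicator (fun _ => r n (u n)) v := by
      filter_upwards [ae_summable h0 hM hneg hQ] with v hv
      have h1 : glue (n + 1) u v ∈ quietUntil a L E n :=
        (glue_mem_quietUntil n.le_succ u v).2 hu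
      have h2 : glue (n + 1) u v ∈ W n ↔ v ∈ S := by
        simp only [W, S, Set.mem_ofPred_eq]
        rw [glue_of_lt n.lt_succ_self, perpetuity_glue (n + 1) u hv.of_abs]
      by_cases hvS : v ∈ S
      · rw [Set.indicator_of_mem hvS]
        simp only [F]
        rw [Set.indicator_of_mem (Set.mem_inter h1 (h2.2 hvS)), glue_of_lt n.lt_succ_self]
      · rw [Set.indicator_of_notMem hvS]
        exact Set.indicator_of_notMem (fun h => hvS (h2.1 h.2)) _
    rw [lintegral_congr_ae hFS, lintegral_indicator_const hS, Set.indicator_of_mem hu, mul_comm]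
    exact mul_le_mul_right (hkey n u hu hun) _
  -- the events are disjoint, as `n` is the first visit to the sets `E`
  have hupper : ∀ s, ∑' n, F n s ≤ ENNReal.ofReal (B (Real.posLog (perpetuity s))) := by
    intro s
    by_cases hs : ∃ n, F n s ≠ 0
    swap
    · push Not at hs
      simp [hs]
    have hmem : ∀ n, F n s ≠ 0 → s ∈ quietUntil a L E n ∩ W n ∧ s n ∈ E n := by
      intro n hn
      have h1 : s ∈ quietUntil a L E n ∩ W n := Set.mem_of_indicator_ne_zero hn
      refine ⟨h1, ?_⟩
      by_contra hcon
      refine hn ?_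
      simp only [F]
      rw [Set.indicator_of_mem h1]
      exact if_neg hcon
    obtain ⟨n, hn⟩ := hs
    obtain ⟨hn1, hn2⟩ := hmem n hn
    rw [tsum_eq_single n fun k hk => ?_]
    · simp only [F]
      rw [Set.indicator_of_mem hn1]
      have : r n (s n) = ENNReal.ofReal (B (η (s n) - a * n - L')) := if_pos hn2
      rw [this]
      exact ENNReal.ofReal_le_ofReal (hB.mono hn1.2)
    · by_contra hk0
      obtain ⟨hk1, hk2⟩ := hmem k hk0
      rcases lt_or_gt_of_ne hk with h | h
      · exact hn1.1.1 k h hk2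
      · exact hk1.1.1 n h hn2
  have hsumr : ∑' n, ∫⁻ x, r n x ∂ρ < ∞ := by
    have h1 : (p * ENNReal.ofReal (1 / 2)) * ∑' n, ∫⁻ x, r n x ∂ρ < ∞ := by
      refine lt_of_le_of_lt ?_ hfin
      rw [← ENNReal.tsum_mul_left]
      calc ∑' n, p * ENNReal.ofReal (1 / 2) * ∫⁻ x, r n x ∂ρ
          ≤ ∑' n, ∫⁻ s, F n s ∂(iidLaw ρ) := ENNReal.tsum_le_tsum fun n => by
            refine le_trans ?_ (hlower n)
            rw [mul_assoc, mul_comm (ENNReal.ofReal (1 / 2))]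
            exact mul_le_mul_right (mul_le_mul_right
              (le_measure_quietUntil htame hE hsum n) _) _
        _ = ∫⁻ s, ∑' n, F n s ∂(iidLaw ρ) :=
            (lintegral_tsum fun n => (hF n).aemeasurable).symm
        _ ≤ _ := lintegral_mono hupper
    have hp2 : p * ENNReal.ofReal (1 / 2) ≠ 0 := mul_ne_zero hp.ne' (by simp)
    by_contra hcon
    rw [not_lt, top_le_iff] at hcon
    rw [hcon, ENNReal.mul_top hp2] at h1
    exact lt_irrefl _ h1
  obtain ⟨K₁, K₂, hK₁, hK₂, hK⟩ := hB.exists_mul_le_tsum ha x₀ L'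
  refine (lintegral_mono fun x => hK (η x) Real.posLog_nonneg).trans_lt ?_
  have hrm : Measurable fun x => ∑' n, r n x := Measurable.tsum hr
  change ∫⁻ x, K₁ + K₂ * ∑' n, r n x ∂ρ < ∞
  rw [lintegral_add_left measurable_const, lintegral_const_mul _ hrm,
    lintegral_tsum fun n => (hr n).aemeasurable]
  simp only [lintegral_const, measure_univ, mul_one]
  exact ENNReal.add_lt_top.2 ⟨hK₁.lt_top, ENNReal.mul_lt_top hK₂.lt_top hsumr⟩

end

/-! ### Transfer to the original probability space -/

theorem coe_logPlus (x : ℝ) : (logPlus x : ℝ) = Real.posLog x := by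
  rw [logPlus, Real.posLog_abs, Real.coe_toNNReal _ Real.posLog_nonneg]

theorem measurable_logPlus : Measurable logPlus := by
  unfold logPlus
  fun_prop

/-- Moments of order `b` and of order `majorant b` are finite simultaneously, also in the presence
of an integrable weight. -/
theorem IsRegularlyVarying.lintegral_majorant_lt_top_iff {b : ℝ≥0 → ℝ≥0} {β : ℝ}
    (hb : IsRegularlyVarying b β) (hβ : 0 < β) (hbdd : ∀ r : ℝ≥0, BddAbove (b '' Set.Iic r))
    {α : Type*} [MeasurableSpace α] {μ : Measure α} {φ w : α → ℝ≥0} (hw : Measurable w)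
    (hwi : ∫⁻ x, (w x : ℝ≥0∞) ∂μ < ∞) :
    ∫⁻ x, ENNReal.ofReal (w x * majorant b (φ x)) ∂μ < ∞ ↔
      ∫⁻ x, ((w x * b (φ x) : ℝ≥0) : ℝ≥0∞) ∂μ < ∞ := by
  obtain ⟨C, hC0, hC⟩ := hb.majorant_le_mul hβ hbdd
  constructor <;> intro h
  · refine (lintegral_mono fun x => ?_).trans_lt h
    rw [← ENNReal.ofReal_coe_nnreal]
    refine ENNReal.ofReal_le_ofReal ?_
    rw [NNReal.coe_mul]
    refine mul_le_mul_of_nonneg_left ?_ (w x).coe_nonneg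
    linarith [le_majorant hbdd (y := φ x) (x := φ x) (by simp)]
  · refine lt_of_le_of_lt (b := ∫⁻ x, C.toNNReal * ((w x : ℝ≥0∞) + (w x * b (φ x) : ℝ≥0)) ∂μ)
      (lintegral_mono fun x => ?_) ?_
    · rw [← ENNReal.coe_add, ← ENNReal.coe_mul, ← ENNReal.ofReal_coe_nnreal]
      refine ENNReal.ofReal_le_ofReal ?_
      push_cast
      rw [Real.coe_toNNReal C hC0]
      linarith [mul_le_mul_of_nonneg_left (hC (φ x)) (w x).coe_nonneg]
    · rw [lintegral_const_mul' _ _ ENNReal.coe_ne_top,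
        lintegral_add_left hw.coe_nnreal_ennreal]
      exact ENNReal.mul_lt_top ENNReal.coe_lt_top (ENNReal.add_lt_top.2 ⟨hwi, h⟩)

end Perpetuity

open Perpetuity in
theorem theorem2p1 {Ω : Type*} [MeasurableSpace Ω] (P : Measure Ω) [IsProbabilityMeasure P]
    -- the generic vector `(M, Q)` and its independent copies `(Ms k, Qs k)`
    (M Q : Ω → ℝ) (Ms Qs : ℕ → Ω → ℝ)
    (hM : Measurable M) (hQ : Measurable Q)
    (hMs : ∀ k, Measurable (Ms k)) (hQs : ∀ k, Measurable (Qs k))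
    (hindep : iIndepFun (fun k ω => (Ms k ω, Qs k ω)) P)
    (hident : ∀ k, IdentDistrib (fun ω => (Ms k ω, Qs k ω)) (fun ω => (M ω, Q ω)) P P)
    -- standing assumptions
    (hM0 : P {ω | M ω = 0} = 0) (hQ0 : P {ω | Q ω = 0} < 1)
    (hnondeg : ¬ ∃ z : ℝ, ∀ᵐ ω ∂P, Perpetuity.zInf Ms Qs ω = z)
    -- `E log |M| ∈ (-∞, 0)` and `E log⁺ |Q| < ∞`
    (hlogM : Integrable (fun ω => Real.log |M ω|) P) (hlogM_neg : ∫ ω, Real.log |M ω| ∂P < 0)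
    (hlogQ : ∫⁻ ω, (Perpetuity.logPlus (Q ω) : ℝ≥0∞) ∂P < ∞)
    -- `b` is locally bounded and regularly varying with index `β > 0`, and `c x = x b x`
    (b c : ℝ≥0 → ℝ≥0) (β : ℝ) (hβ : 0 < β) (hb : Perpetuity.IsRegularlyVarying b β)
    (hb_bdd : ∀ r : ℝ≥0, BddAbove (b '' Set.Iic r))
    (hc : ∀ x, c x = x * b x) :
    (∀ᵐ ω ∂P, Summable (fun k => |Perpetuity.prodPi Ms k ω * Qs k ω|)) ∧
    (∫⁻ ω, (b (Perpetuity.logPlus (Perpetuity.zInf Ms Qs ω)) : ℝ≥0∞) ∂P < ∞ ↔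
      ∫⁻ ω, (c (Perpetuity.logPlus (M ω)) : ℝ≥0∞) ∂P < ∞ ∧
      ∫⁻ ω, (c (Perpetuity.logPlus (Q ω)) : ℝ≥0∞) ∂P < ∞) := by
  set ρ : Measure (ℝ × ℝ) := P.map fun ω => (M ω, Q ω)
  have hMQ : Measurable fun ω => (M ω, Q ω) := hM.prodMk hQ
  have hρ : IsProbabilityMeasure ρ := Measure.isProbabilityMeasure_map hMQ.aemeasurable
  set X : Ω → ℕ → ℝ × ℝ := fun ω k => (Ms k ω, Qs k ω)
  have hXk : ∀ k, Measurable fun ω => (Ms k ω, Qs k ω) := fun k => (hMs k).prodMk (hQs k)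
  have hX : Measurable X := measurable_pi_lambda _ hXk
  have hlaw : P.map X = iidLaw ρ := by
    rw [(iIndepFun_iff_map_fun_eq_infinitePi_map hXk).1 hindep]
    congr 1
    funext k
    exact (hident k).map_eq
  have hmp : MeasurePreserving X P (iidLaw ρ) := ⟨hX, hlaw⟩
  have hmpρ : MeasurePreserving (fun ω => (M ω, Q ω)) P ρ := ⟨hMQ, rfl⟩
  have h0 : ∀ᵐ x ∂ρ, x.1 ≠ 0 := by
    have hm : MeasurableSet {x : ℝ × ℝ | x.1 ≠ 0} :=
      (measurableSet_eq_fun measurable_fst measurable_const).compl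
    rw [ae_map_iff hMQ.aemeasurable hm]
    exact measure_eq_zero_iff_ae_notMem.1 hM0
  have hintρ : ∀ {f : ℝ × ℝ → ℝ}, Measurable f → Integrable (fun ω => f (M ω, Q ω)) P →
      Integrable f ρ := fun hf h =>
    (integrable_map_measure hf.aestronglyMeasurable hMQ.aemeasurable).2 h
  have hMρ : Integrable (fun x : ℝ × ℝ => Real.log |x.1|) ρ := hintρ (by fun_prop) hlogM
  have hnegρ : ∫ x, Real.log |x.1| ∂ρ < 0 := by
    have hm : Measurable fun x : ℝ × ℝ => Real.log |x.1| := by fun_prop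
    rw [integral_map hMQ.aemeasurable hm.aestronglyMeasurable]
    exact hlogM_neg
  have hintegrable : ∀ {f : ℝ × ℝ → ℝ}, Measurable f → (∀ x, 0 ≤ f x) →
      ∫⁻ ω, ENNReal.ofReal (f (M ω, Q ω)) ∂P < ∞ → Integrable f ρ := fun hf hf0 h =>
    hintρ hf ⟨(hf.comp hMQ).aestronglyMeasurable,
      (hasFiniteIntegral_iff_ofReal (ae_of_all _ fun _ => hf0 _)).2 h⟩
  have hQρ : Integrable (fun x : ℝ × ℝ => Real.posLog x.2) ρ := by
    refine hintegrable (by fun_prop) (fun _ => Real.posLog_nonneg) ?_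
    simpa only [← coe_logPlus, ENNReal.ofReal_coe_nnreal] using hlogQ
  have hMp : Integrable (fun x : ℝ × ℝ => Real.posLog x.1) ρ := by
    refine Integrable.mono' hMρ.abs (by fun_prop : Measurable _).aestronglyMeasurable
      (ae_of_all _ fun x => ?_)
    rw [Real.norm_of_nonneg Real.posLog_nonneg, Real.log_abs]
    exact max_le (abs_nonneg _) (le_abs_self _)
  have hlogM' : ∫⁻ ω, (logPlus (M ω) : ℝ≥0∞) ∂P < ∞ := by
    have h1 : Integrable (fun ω => Real.posLog (M ω)) P := hmpρ.integrable_comp_of_integrable hMp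
    have h2 := (hasFiniteIntegral_iff_ofReal (ae_of_all _ fun _ => Real.posLog_nonneg)).1 h1.2
    simpa only [← coe_logPlus, ENNReal.ofReal_coe_nnreal] using h2
  have hsum := ae_summable h0 hMρ hnegρ hQρ
  have hB := hb.isGauge_majorant hb_bdd
  set B := IsRegularlyVarying.majorant b
  have hBm : Measurable B := hB.mono.measurable
  have hZ : ∫⁻ ω, (b (logPlus (zInf Ms Qs ω)) : ℝ≥0∞) ∂P < ∞ ↔
      ∫⁻ s, ENNReal.ofReal (B (Real.posLog (perpetuity s))) ∂(iidLaw ρ) < ∞ := by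
    have h1 := hb.lintegral_majorant_lt_top_iff hβ hb_bdd (μ := P)
      (φ := fun ω => logPlus (zInf Ms Qs ω)) (w := fun _ => 1) measurable_const (by simp)
    simp only [NNReal.coe_one, one_mul, coe_logPlus] at h1
    rw [← h1, ← hmp.lintegral_comp (by fun_prop)]
    rfl
  have hcY : ∀ {Y : Ω → ℝ}, Measurable Y → ∫⁻ ω, (logPlus (Y ω) : ℝ≥0∞) ∂P < ∞ →
      (∫⁻ ω, (c (logPlus (Y ω)) : ℝ≥0∞) ∂P < ∞ ↔
        ∫⁻ ω, ENNReal.ofReal (Real.posLog (Y ω) * B (Real.posLog (Y ω))) ∂P < ∞) := by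
    intro Y hY hYi
    have h1 := hb.lintegral_majorant_lt_top_iff hβ hb_bdd (μ := P)
      (φ := fun ω => logPlus (Y ω)) (measurable_logPlus.comp hY) hYi
    simp only [Function.comp_apply, coe_logPlus] at h1
    simp only [hc]
    exact h1.symm
  have hnondegρ : ¬ ∃ z, ∀ᵐ s ∂(iidLaw ρ), perpetuity s = z := fun ⟨z, hz⟩ =>
    hnondeg ⟨z, hmp.quasiMeasurePreserving.ae hz⟩
  refine ⟨hmp.quasiMeasurePreserving.ae hsum, ?_⟩
  rw [hZ, hcY hM hlogM', hcY hQ hlogQ]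
  constructor
  · intro hfin
    have hkey : ∀ {Y : ℝ × ℝ → ℝ}, Measurable Y → Integrable (fun x => Real.posLog (Y x)) ρ →
        (∀ (x : ℝ × ℝ) (A R : ℝ), |R * Y x| ≤ |A| + max |A + R * x.2| |R * x.1|) →
        ∫⁻ ω, ENNReal.ofReal (Real.posLog (Y (M ω, Q ω)) * B (Real.posLog (Y (M ω, Q ω)))) ∂P
          < ∞ := by
      intro Y hY hYi hYle
      have h1 := lintegral_mul_lt_top_of_lintegral_perpetuity hB h0 hMρ hnegρ hQρ hnondegρ hfin
        hY hYi hYle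
      rwa [← hmpρ.lintegral_comp (by fun_prop)] at h1
    refine ⟨hkey measurable_fst hMp fun x A R => ?_, hkey measurable_snd hQρ fun x A R => ?_⟩
    · exact (le_max_right _ _).trans (le_add_of_nonneg_left (abs_nonneg A))
    · have h1 := abs_sub (A + R * x.2) A
      rw [add_sub_cancel_left] at h1
      linarith [le_max_left |A + R * x.2| |R * x.1|]
  · rintro ⟨h1, h2⟩
    have hnn : ∀ y, 0 ≤ Real.posLog y * B (Real.posLog y) := fun y =>
      mul_nonneg Real.posLog_nonneg (hB.nonneg _)
    exact lintegral_perpetuity_lt_top hB h0 hMρ hnegρ hQρ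
      (hintegrable (by fun_prop) (fun _ => hnn _) h1)
      (hintegrable (by fun_prop) (fun _ => hnn _) h2)
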